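/- **Theorem 2.5.** Let $n\ge 1$, let $\mathbb F_n^+$ be the unital free semigroup on generators $g_1,\dots,g_n$ with neutral element $g_0$, and let $|\alpha|$ denote the length of the word $\alpha\in\mathbb F_n^+$. For bounded operators $T_1,\dots,T_n$ on a Hilbert space put $T_\alpha:=T_{i_1}\cdots T_{i_k}$ if $\alpha=g_{i_1}\cdots g_{i_k}$, and $T_{g_0}:=I$. All Hilbert spaces are complex, and $\otimes$ is the Hilbert space tensor product. Let $\mathcal H$ be a Hilbert space and let $A_{(\alpha)}\in B(\mathcal H)$, $\alpha\in\mathbb F_n^+$, with $A_{(0)}:=A_{(g_0)}$, be such that $$F(X_1,\dots,X_n)=\sum_{k=0}^\infty\sum_{|\alpha|=k}X_\alpha\otimes A_{(\alpha)}$$ is a holomorphic function on the open unit ball $[B(\mathcal X)^n]_{<1}:=\{(X_1,\dots,X_n)\in B(\mathcal X)^n:\ \|X_1X_1^*+\cdots+X_nX_n^*\|<1\}$, that is, the series in $k$ converges in the operator norm for every Hilbert space $\mathcal X$ and every $(X_1,\dots,X_n)\in[B(\mathcal X)^n]_{<1}$. Suppose that $F(0)\ge 0$ and that $\operatorname{Re}F(X_1,\dots,X_n)\le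 I$ for every Hilbert space $\mathcal X$ and every $(X_1,\dots,X_n)\in[B(\mathcal X)^n]_{<1}$. Let $S_1,\dots,S_n$ be the left creation operators $S_i\varphi=e_i\otimes\varphi$ on the full Fock space $F^2(H_n)=\bigoplus_{k\ge0}H_n^{\otimes k}$, where $H_n$ is an $n$-dimensional Hilbert space with orthonormal basis $e_1,\dots,e_n$. Then: 1. If $\mathcal K$ is a Hilbert space and $Y_1,\dots,Y_n\in B(\mathcal K)$ satisfy $\|[Y_1^*,\dots,Y_n^*]\|\le\frac13$ (the norm of the row operator $\mathcal K^n\to\mathcal K$), then the series defining $F(S_1\otimes Y_1,\dots,S_n\otimes Y_n)$ converges in the operator norm and $\|F(S_1\otimes Y_1,\dots,S_n\otimes Y_n)\|\le1$. 2. $\sum_{|\alpha|=k}A_{(\alpha)}^*A_{(\alpha)}\le4(I-A_{(0)})$ for every $k\ge1$. 3. $\bigl\|\sum_{|\alpha|=k}A_{(\alpha)}^*A_{(\alpha)}\bigr\|^{1/2}\le2\|I-A_{(0)}\|$ for every $k\ge1$. 4. For $0\le r<1$, $$\sum_{k=0}^\infty r^k\Bigl(\sum_{|\alpha|=k}A_{(\alpha)}^*A_{(\alpha)}\Bigr)^{1/2}\le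 M(r)I,\qquad M(r):=\begin{cases}1+\dfrac{r^2}{(1-r)^2}&\text{if }0\le r\le\frac12,\\[1ex]\dfrac{2r}{1-r}&\text{if }\frac12<r<1,\end{cases}$$ where the series converges in the operator norm. 5. If $\|A_{(0)}\|<1$, then $I-A_{(0)}$ is invertible, and for $0\le r<1$ $$A_{(0)}+\sum_{k=1}^\infty\sum_{|\alpha|=k}r^kA_{(\alpha)}^*(I-A_{(0)})^{-1}A_{(\alpha)}\le K(r)I,\qquad K(r):=\begin{cases}1&\text{if }0\le r\le\frac15,\\[1ex]\dfrac{4r}{1-r}&\text{if }\frac15<r<1,\end{cases}$$ where the series in $k$ converges in the operator norm. 6. For $0\le r\le\frac13$, $\displaystyle\sum_{k=0}^\infty r^k\Bigl\|\sum_{|\alpha|=k}A_{(\alpha)}^*A_{(\alpha)}\Bigr\|^{1/2}\le\|A_{(0)}\|+\|I-A_{(0)}\|$. -/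

import Mathlib

open scoped TensorProduct Topology

universe v w u

namespace NCBohr

noncomputable section

/-- Words of length `k` in the unital free semigroup on `n` generators. -/
def words (n k : ℕ) : Finset (FreeMonoid (Fin n)) :=
  Finset.univ.map ⟨fun w : Fin k → Fin n => FreeMonoid.ofList (List.ofFn w),
    FreeMonoid.ofList.injective.comp List.ofFn_injective⟩

theorem mem_words {n k : ℕ} {α : FreeMonoid (Fin n)} : α ∈ words n k ↔ α.length = k := by
  simp only [words, Finset.mem_map, Finset.mem_univ, true_and,
    Function.Embedding.coeFn_mk]
  constructor
  · rintro ⟨w, rfl⟩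
    simp [FreeMonoid.length]
  · rintro rfl
    exact ⟨fun i => α.toList.get i, by
      apply FreeMonoid.toList.injective
      simp only [FreeMonoid.toList_ofList]
      exact List.ofFn_get _⟩

/-- The bounded operators on a complex inner product space. -/
abbrev BOp (E : Type*) [NormedAddCommGroup E] [InnerProductSpace ℂ E] := E →L[ℂ] E

/-- The Hilbert space tensor product: the completion of the algebraic tensor product for the
inner product determined by `⟪x ⊗ y, x' ⊗ y'⟫ = ⟪x, x'⟫ * ⟪y, y'⟫`. -/
abbrev HilbertTensor (E F : Type*) [NormedAddCommGroup E] [InnerProductSpace ℂ E]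
    [NormedAddCommGroup F] [InnerProductSpace ℂ F] :=
  UniformSpace.Completion (E ⊗[ℂ] F)

/-- The bounded operator `S ⊗ T` on the Hilbert space tensor product. -/
def opTensor {E F : Type*} [NormedAddCommGroup E] [InnerProductSpace ℂ E]
    [NormedAddCommGroup F] [InnerProductSpace ℂ F] (S : BOp E) (T : BOp F) :
    BOp (HilbertTensor E F) :=
  (TensorProduct.mapL S T).completion

theorem opTensor_tmul {E F : Type*} [NormedAddCommGroup E] [InnerProductSpace ℂ E]
    [NormedAddCommGroup F] [InnerProductSpace ℂ F] (S : BOp E) (T : BOp F) (x : E) (y : F) :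
    opTensor S T ((x ⊗ₜ[ℂ] y : E ⊗[ℂ] F) : HilbertTensor E F)
      = ((S x ⊗ₜ[ℂ] T y : E ⊗[ℂ] F) : HilbertTensor E F) :=
  UniformSpace.Completion.map_coe (TensorProduct.mapL S T).uniformContinuous _

/-- `T_α = T_{i₁} ⋯ T_{i_k}` for `α = g_{i₁} ⋯ g_{i_k}`, and `T_α = I` for the empty word. -/
def evalWord {n : ℕ} {E : Type*} [NormedAddCommGroup E] [InnerProductSpace ℂ E]
    (T : Fin n → BOp E) (α : FreeMonoid (Fin n)) : BOp E :=
  FreeMonoid.lift T α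

/-- The full Fock space of an `n`-dimensional Hilbert space with orthonormal basis
`e_1, …, e_n`, in the coordinates of its orthonormal basis
`e_α = e_{i₁} ⊗ ⋯ ⊗ e_{i_k}` indexed by the words `α = g_{i₁} ⋯ g_{i_k}`. -/
abbrev FockSpace (n : ℕ) := lp (fun _ : FreeMonoid (Fin n) => ℂ) 2

theorem of_mul_injective {n : ℕ} (i : Fin n) :
    Function.Injective fun β : FreeMonoid (Fin n) => FreeMonoid.of i * β :=
  fun _ _ h => mul_left_cancel h

/-- The coordinates of `e_i ⊗ φ`: the value at `g_i β` is `φ(β)`, and the value at a word that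
does not begin with the letter `g_i` is `0`. -/
def creationFun {n : ℕ} (i : Fin n) (φ : FreeMonoid (Fin n) → ℂ) : FreeMonoid (Fin n) → ℂ :=
  Function.extend (fun β : FreeMonoid (Fin n) => FreeMonoid.of i * β) φ 0

theorem creationFun_of_mul {n : ℕ} (i : Fin n) (φ : FreeMonoid (Fin n) → ℂ)
    (β : FreeMonoid (Fin n)) : creationFun i φ (FreeMonoid.of i * β) = φ β :=
  (of_mul_injective i).extend_apply _ _ _

theorem creationFun_of_ne {n : ℕ} (i : Fin n) (φ : FreeMonoid (Fin n) → ℂ)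
    (α : FreeMonoid (Fin n)) (h : ¬ ∃ β, FreeMonoid.of i * β = α) : creationFun i φ α = 0 :=
  Function.extend_apply' _ _ _ h

theorem creationFun_sq {n : ℕ} (i : Fin n) (φ : FreeMonoid (Fin n) → ℂ) :
    (fun α => ‖creationFun i φ α‖ ^ 2)
      = Function.extend (fun β : FreeMonoid (Fin n) => FreeMonoid.of i * β)
          (fun β => ‖φ β‖ ^ 2) 0 := by
  funext α
  by_cases h : ∃ β, FreeMonoid.of i * β = α
  · obtain ⟨β, rfl⟩ := h
    rw [creationFun_of_mul, (of_mul_injective i).extend_apply]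
  · rw [creationFun_of_ne i φ α h, Function.extend_apply' _ _ _ h]
    simp

theorem creationFun_memℓp {n : ℕ} (i : Fin n) (φ : FockSpace n) :
    Memℓp (E := fun _ : FreeMonoid (Fin n) => ℂ) (creationFun i φ) 2 := by
  refine memℓp_gen ?_
  have h := (memℓp_gen_iff (by norm_num)).1 (lp.memℓp φ)
  simp only [ENNReal.toReal_ofNat, Real.rpow_ofNat] at h ⊢
  rw [creationFun_sq]
  refine (Function.Injective.summable_iff (of_mul_injective i) (fun α hα => ?_)).1 ?_
  · rw [Function.extend_apply' _ _ _ (by simpa using hα)]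
    rfl
  · simpa [Function.comp_def, (of_mul_injective i).extend_apply] using h

/-- The left creation operator `S_i φ = e_i ⊗ φ`. -/
def creation {n : ℕ} (i : Fin n) : BOp (FockSpace n) :=
  LinearIsometry.toContinuousLinearMap
    { toFun := fun φ => ⟨creationFun i φ, creationFun_memℓp i φ⟩
      map_add' := by
        intro φ ψ
        refine lp.ext (funext fun α => ?_)
        change creationFun i ((φ : FreeMonoid (Fin n) → ℂ) + ψ) α
          = creationFun i φ α + creationFun i ψ α
        by_cases h : ∃ β, FreeMonoid.of i * β = α
        · obtain ⟨β, rfl⟩ := h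
          simp only [creationFun_of_mul, Pi.add_apply]
        · simp [creationFun_of_ne i _ α h]
      map_smul' := by
        intro c φ
        refine lp.ext (funext fun α => ?_)
        change creationFun i (c • (φ : FreeMonoid (Fin n) → ℂ)) α = c • creationFun i φ α
        by_cases h : ∃ β, FreeMonoid.of i * β = α
        · obtain ⟨β, rfl⟩ := h
          simp only [creationFun_of_mul, Pi.smul_apply]
        · simp [creationFun_of_ne i _ α h]
      norm_map' := by
        intro φ
        rw [lp.norm_eq_tsum_rpow (by norm_num), lp.norm_eq_tsum_rpow (by norm_num)]
        simp only [ENNReal.toReal_ofNat, Real.rpow_ofNat]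
        congr 1
        change ∑' α, ‖creationFun i φ α‖ ^ 2 = _
        rw [creationFun_sq]
        exact tsum_extend_zero (of_mul_injective i) _ }

theorem creation_apply {n : ℕ} (i : Fin n) (φ : FockSpace n) (α : FreeMonoid (Fin n)) :
    creation i φ α = creationFun i φ α :=
  rfl

/-- The homogeneous part `∑_{|α| = k} X_α ⊗ A_α`. -/
def homPart {n : ℕ} {H E : Type*} [NormedAddCommGroup H] [InnerProductSpace ℂ H]
    [NormedAddCommGroup E] [InnerProductSpace ℂ E] (A : FreeMonoid (Fin n) → BOp H)
    (X : Fin n → BOp E) (k : ℕ) : BOp (HilbertTensor E H) :=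
  ∑ α ∈ words n k, opTensor (evalWord X α) (A α)

/-- The series `F(X) = ∑_k ∑_{|α| = k} X_α ⊗ A_α` converges in the operator norm, with sum `L`. -/
def HasValue {n : ℕ} {H E : Type*} [NormedAddCommGroup H] [InnerProductSpace ℂ H]
    [NormedAddCommGroup E] [InnerProductSpace ℂ E] (A : FreeMonoid (Fin n) → BOp H)
    (X : Fin n → BOp E) (L : BOp (HilbertTensor E H)) : Prop :=
  Filter.Tendsto (fun N => ∑ k ∈ Finset.range N, homPart A X k) Filter.atTop (𝓝 L)

/-- The open unit ball `[B(E)^n]_{<1}`. -/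
def opBall (n : ℕ) (E : Type*) [NormedAddCommGroup E] [InnerProductSpace ℂ E]
    [CompleteSpace E] : Set (Fin n → BOp E) :=
  {X | ‖∑ i, X i * star (X i)‖ < 1}

/-- The row operator `[T_1, …, T_n] : E ⊕ ⋯ ⊕ E → E`. -/
def rowOp {n : ℕ} {E : Type*} [NormedAddCommGroup E] [InnerProductSpace ℂ E]
    (T : Fin n → BOp E) : PiLp 2 (fun _ : Fin n => E) →L[ℂ] E :=
  ∑ i, T i ∘L PiLp.proj 2 (fun _ : Fin n => E) i

/-- The coefficients `A` generate a holomorphic function on the open unit ball: the series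
converges in norm at every point of `[B(E)^n]_{<1}`, for every Hilbert space `E`
(of an arbitrary universe `v`). -/
def IsHolomorphicOnBall {n : ℕ} {H : Type u} [NormedAddCommGroup H]
    [InnerProductSpace ℂ H] (A : FreeMonoid (Fin n) → BOp H) : Prop :=
  ∀ (E : Type v) [NormedAddCommGroup E] [InnerProductSpace ℂ E] [CompleteSpace E]
    (X : Fin n → BOp E), X ∈ opBall n E → ∃ L, HasValue A X L

/-- `F(0) ≥ 0`, for every underlying Hilbert space. -/
def NonnegAtZero {n : ℕ} {H : Type u} [NormedAddCommGroup H]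
    [InnerProductSpace ℂ H] (A : FreeMonoid (Fin n) → BOp H) : Prop :=
  ∀ (E : Type v) [NormedAddCommGroup E] [InnerProductSpace ℂ E] [CompleteSpace E]
    (L : BOp (HilbertTensor E H)), HasValue A (0 : Fin n → BOp E) L → 0 ≤ L

/-- `Re F(X) ≤ I` for every `X` in the open unit ball, for every underlying Hilbert space. -/
def ReLeOneOnBall {n : ℕ} {H : Type u} [NormedAddCommGroup H]
    [InnerProductSpace ℂ H] (A : FreeMonoid (Fin n) → BOp H) : Prop :=
  ∀ (E : Type v) [NormedAddCommGroup E] [InnerProductSpace ℂ E] [CompleteSpace E]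
    (X : Fin n → BOp E), X ∈ opBall n E →
      ∀ L : BOp (HilbertTensor E H), HasValue A X L → (realPart L : BOp (HilbertTensor E H)) ≤ 1

/-- The sum `∑_{|α| = k} A_α^* A_α`. -/
def coeffSq {n : ℕ} {H : Type*} [NormedAddCommGroup H] [InnerProductSpace ℂ H]
    [CompleteSpace H] (A : FreeMonoid (Fin n) → BOp H) (k : ℕ) : BOp H :=
  ∑ α ∈ words n k, star (A α) * A α

/-- The constant `M(r)`, for `0 ≤ r < 1`. -/
def M (r : ℝ) : ℝ := if r ≤ 1 / 2 then 1 + r ^ 2 / (1 - r) ^ 2 else 2 * r / (1 - r)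

/-- The constant `K(r)`, for `0 ≤ r < 1`. -/
def K (r : ℝ) : ℝ := if r ≤ 1 / 5 then 1 else 4 * r / (1 - r)

end

end NCBohr

/-! Put `B = 1 - A 1`. The creation operators, scaled by `r < 1`, lie in the open ball, so `Re F(rS)
≤ 1` may be tested on vectors of the Fock space tensored with `H`. On vectors supported on the empty
word and the words of length `k`, the operator `F(rS)` has only the coefficients `A 1` on the
diagonal and `r ^ k A_α` in the first column. Letting `r → 1` gives, for all `x` and `y_α`, `∑
Re⟪y_α, A_α x⟫ ≤ ⟪x, B x⟫ + ∑ ⟪y_α, B y_α⟫`, which is `re_inner_coeff_le`, abstracted as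
`IsDominated`. Together with `0 ≤ A 1 ≤ 1` it implies all six assertions.

The choice `y_α = t A_α x` gives `∑ A_α^* A_α ≤ 4‖B‖ B`, and `y_α = (1/2) B⁻¹ A_α x` gives `∑ A_α^*
B⁻¹ A_α ≤ 4 B`. Assertions 2 to 6 follow by geometric summation; for assertion 4, operator
monotonicity of the square root is used and a square is completed in `√B`.

For assertion 1, the inequality for a single word yields `A_α = 2 b Γ_α b` with `b = √(B + ε)` and
`‖Γ_α‖ ≤ 1`. The operators `S_α ⊗ Y_α` with `|α| = k` have orthogonal ranges, so the `k`-th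
homogeneous sum with coefficients `Γ_α` has norm at most `(1/3) ^ k` (`norm_sum_opTensor_le`). Since
`∑_{k ≥ 1} 2 (1/3) ^ k = 1`, each partial sum with its constant term has the form `A 1 + b D b`, up
to tensoring with the identity, where `‖D‖ ≤ 1`. As `A 1 + b² = 1 + ε`, its norm is at most `1 + ε`
(`norm_mul_self_add_conj_le`), and `ε` is arbitrary. -/

namespace NCBohr

noncomputable section

/-! ### Tensor products of bounded operators -/

section OpTensor

variable {E F : Type*} [NormedAddCommGroup E] [InnerProductSpace ℂ E]
  [NormedAddCommGroup F] [InnerProductSpace ℂ F]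

/-- Bounded operators on the Hilbert tensor product that agree on elementary tensors are equal. -/
theorem hilbertTensor_ext {G : Type*} [NormedAddCommGroup G] [NormedSpace ℂ G]
    {P Q : HilbertTensor E F →L[ℂ] G}
    (h : ∀ x y, P ((x ⊗ₜ[ℂ] y : E ⊗[ℂ] F) : HilbertTensor E F)
      = Q ((x ⊗ₜ[ℂ] y : E ⊗[ℂ] F) : HilbertTensor E F)) : P = Q := by
  ext z
  induction z using UniformSpace.Completion.induction_on with
  | hp => exact isClosed_eq P.continuous Q.continuous
  | ih a =>
    induction a using TensorProduct.induction_on with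
    | zero => rw [UniformSpace.Completion.coe_zero, map_zero, map_zero]
    | tmul x y => exact h x y
    | add a b ha hb => rw [UniformSpace.Completion.coe_add, map_add, map_add, ha, hb]

theorem inner_tmul_coe (x x' : E) (y y' : F) :
    inner ℂ ((x ⊗ₜ[ℂ] y : E ⊗[ℂ] F) : HilbertTensor E F)
      ((x' ⊗ₜ[ℂ] y' : E ⊗[ℂ] F) : HilbertTensor E F) = inner ℂ x x' * inner ℂ y y' := by
  rw [UniformSpace.Completion.inner_coe, TensorProduct.inner_tmul]

theorem opTensor_mul (S S' : BOp E) (T T' : BOp F) :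
    opTensor (S * S') (T * T') = opTensor S T * opTensor S' T' :=
  hilbertTensor_ext fun x y => by simp [opTensor_tmul]

theorem opTensor_one_one : opTensor (1 : BOp E) (1 : BOp F) = 1 :=
  hilbertTensor_ext fun x y => by simp [opTensor_tmul]

theorem opTensor_zero_left (T : BOp F) : opTensor (0 : BOp E) T = 0 :=
  hilbertTensor_ext fun x y => by simp [opTensor_tmul]

theorem opTensor_add_left (S S' : BOp E) (T : BOp F) :
    opTensor (S + S') T = opTensor S T + opTensor S' T :=
  hilbertTensor_ext fun x y => by
    simp [opTensor_tmul, TensorProduct.add_tmul, UniformSpace.Completion.coe_add]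

theorem opTensor_add_right (S : BOp E) (T T' : BOp F) :
    opTensor S (T + T') = opTensor S T + opTensor S T' :=
  hilbertTensor_ext fun x y => by
    simp [opTensor_tmul, TensorProduct.tmul_add, UniformSpace.Completion.coe_add]

theorem opTensor_smul_right (c : ℂ) (S : BOp E) (T : BOp F) :
    opTensor S (c • T) = c • opTensor S T :=
  hilbertTensor_ext fun x y => by
    simp [opTensor_tmul]

theorem opTensor_sum_left {ι : Type*} (s : Finset ι) (S : ι → BOp E) (T : BOp F) :
    opTensor (∑ i ∈ s, S i) T = ∑ i ∈ s, opTensor (S i) T := by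
  classical
  induction s using Finset.induction_on with
  | empty => simp [opTensor_zero_left]
  | insert a s ha ih => rw [Finset.sum_insert ha, Finset.sum_insert ha, opTensor_add_left, ih]

theorem opTensor_sum_right {ι : Type*} (s : Finset ι) (S : BOp E) (T : ι → BOp F) :
    opTensor S (∑ i ∈ s, T i) = ∑ i ∈ s, opTensor S (T i) := by
  classical
  induction s using Finset.induction_on with
  | empty => simpa using opTensor_smul_right 0 S (0 : BOp F)
  | insert a s ha ih => rw [Finset.sum_insert ha, Finset.sum_insert ha, opTensor_add_right, ih]

theorem norm_opTensor_le (S : BOp E) (T : BOp F) : ‖opTensor S T‖ ≤ ‖S‖ * ‖T‖ := by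
  refine ContinuousLinearMap.opNorm_le_bound _ (by positivity) fun z => ?_
  induction z using UniformSpace.Completion.induction_on with
  | hp => exact isClosed_le (by fun_prop) (by fun_prop)
  | ih a =>
    rw [opTensor, ContinuousLinearMap.completion_apply_coe, UniformSpace.Completion.norm_coe,
      UniformSpace.Completion.norm_coe]
    exact (ContinuousLinearMap.le_opNorm _ _).trans
      (mul_le_mul_of_nonneg_right (TensorProduct.norm_mapL_le S T) (norm_nonneg _))

theorem inner_opTensor [CompleteSpace E] [CompleteSpace F] (S : BOp E) (T : BOp F)
    (z z' : HilbertTensor E F) :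
    inner ℂ (opTensor (star S) (star T) z) z' = inner ℂ z (opTensor S T z') := by
  induction z, z' using UniformSpace.Completion.induction_on₂ with
  | hp => exact isClosed_eq (by fun_prop) (by fun_prop)
  | ih a b =>
    induction a using TensorProduct.induction_on with
    | zero =>
      rw [UniformSpace.Completion.coe_zero, map_zero, inner_zero_left, inner_zero_left]
    | add a a' ha ha' =>
      rw [UniformSpace.Completion.coe_add, map_add, inner_add_left, inner_add_left, ha, ha']
    | tmul x y =>
      induction b using TensorProduct.induction_on with
      | zero =>
        rw [UniformSpace.Completion.coe_zero, map_zero, inner_zero_right, inner_zero_right]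
      | add b b' hb hb' =>
        rw [UniformSpace.Completion.coe_add, map_add, inner_add_right, inner_add_right, hb, hb']
      | tmul x' y' =>
        simp only [opTensor_tmul, inner_tmul_coe, ContinuousLinearMap.star_eq_adjoint,
          ContinuousLinearMap.adjoint_inner_left]

theorem star_opTensor [CompleteSpace E] [CompleteSpace F] (S : BOp E) (T : BOp F) :
    star (opTensor S T) = opTensor (star S) (star T) := by
  rw [ContinuousLinearMap.star_eq_adjoint]
  symm
  rw [ContinuousLinearMap.eq_adjoint_iff]
  exact inner_opTensor S T

end OpTensor

/-! ### Words and their evaluation -/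

section Words

variable {n : ℕ} {E : Type*} [NormedAddCommGroup E] [InnerProductSpace ℂ E]

theorem words_zero : words n 0 = {1} := by
  ext α
  rw [mem_words, Finset.mem_singleton, FreeMonoid.length_eq_zero]

theorem evalWord_one (T : Fin n → BOp E) : evalWord T 1 = 1 := map_one _

theorem evalWord_mul (T : Fin n → BOp E) (α β : FreeMonoid (Fin n)) :
    evalWord T (α * β) = evalWord T α * evalWord T β := map_mul _ _ _

theorem evalWord_of (T : Fin n → BOp E) (i : Fin n) : evalWord T (FreeMonoid.of i) = T i :=
  FreeMonoid.lift_eval_of _ _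

theorem evalWord_smul (c : ℂ) (T : Fin n → BOp E) (α : FreeMonoid (Fin n)) :
    evalWord (fun i => c • T i) α = c ^ α.length • evalWord T α := by
  induction α using FreeMonoid.inductionOn' with
  | one => simp [evalWord_one]
  | of_mul i β ih =>
    rw [evalWord_mul, evalWord_mul, ih, evalWord_of, evalWord_of, FreeMonoid.length_mul,
      FreeMonoid.length_of, smul_mul_smul_comm, pow_add, pow_one]

/-- A sum over the words of length `k + 1`, split according to the first letter. -/
theorem sum_words_succ {M : Type*} [AddCommMonoid M] (k : ℕ) (f : FreeMonoid (Fin n) → M) :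
    ∑ α ∈ words n (k + 1), f α = ∑ β ∈ words n k, ∑ i, f (FreeMonoid.of i * β) := by
  simp only [words, Finset.sum_map, Function.Embedding.coeFn_mk]
  rw [← Fintype.sum_equiv (Fin.consEquiv fun _ => Fin n)
    (fun p => f (FreeMonoid.of p.1 * FreeMonoid.ofList (List.ofFn p.2))) _ fun p => ?_]
  · rw [Fintype.sum_prod_type_right]
  · congr 1
    simp [Fin.consEquiv, List.ofFn_succ]

end Words

/-! ### Creation operators on the Fock space -/

section Creation

variable {n : ℕ}

theorem inner_creation (i j : Fin n) (φ ψ : FockSpace n) :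
    inner ℂ (creation i φ) (creation j ψ) = if i = j then inner ℂ φ ψ else 0 := by
  split_ifs with h
  · subst h
    have h : ∀ x : FockSpace n, ‖creation i x‖ = ‖x‖ := by
      unfold creation
      intro x
      rw [LinearIsometry.coe_toContinuousLinearMap]
      exact LinearIsometry.norm_map _ x
    exact LinearIsometry.inner_map_map ⟨(creation i).toLinearMap, h⟩ φ ψ
  · rw [lp.inner_eq_tsum]
    refine (tsum_congr fun α => ?_).trans tsum_zero
    rw [creation_apply, creation_apply]
    by_cases hi : ∃ β, FreeMonoid.of i * β = α
    -- No word begins with two different letters, so the supports are disjoint.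
    · rw [creationFun_of_ne j, inner_zero_right]
      rintro ⟨γ, hγ⟩
      obtain ⟨β, rfl⟩ := hi
      have := congrArg FreeMonoid.toList hγ
      simp only [FreeMonoid.toList_mul, FreeMonoid.toList_of, List.singleton_append,
        List.cons.injEq] at this
      exact h this.1.symm
    · rw [creationFun_of_ne i _ α hi, inner_zero_left]

open Classical in
/-- The orthonormal basis vectors `e_α` of the Fock space. -/
def fockBasis (α : FreeMonoid (Fin n)) : FockSpace n := lp.single 2 α (1 : ℂ)

theorem orthonormal_fockBasis : Orthonormal ℂ (fockBasis (n := n)) := by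
  classical
  rw [orthonormal_iff_ite]
  intro α β
  rw [fockBasis, lp.inner_single_left, fockBasis, lp.coeFn_single, Pi.single_apply]
  simp

theorem creation_fockBasis (i : Fin n) (β : FreeMonoid (Fin n)) :
    creation i (fockBasis β) = fockBasis (FreeMonoid.of i * β) := by
  classical
  refine lp.ext (funext fun α => ?_)
  rw [creation_apply, fockBasis, fockBasis, lp.coeFn_single, lp.coeFn_single]
  by_cases h : ∃ γ, FreeMonoid.of i * γ = α
  · obtain ⟨γ, rfl⟩ := h
    rw [creationFun_of_mul, Pi.single_apply, Pi.single_apply]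
    simp
  · rw [creationFun_of_ne i _ α h, Pi.single_apply, if_neg]
    rintro rfl
    exact h ⟨β, rfl⟩

end Creation

/-! ### Isometries with orthogonal ranges -/

section Isometries

variable {n : ℕ} {E : Type*} [NormedAddCommGroup E] [InnerProductSpace ℂ E] [CompleteSpace E]

theorem star_mul_of_inner {S : Fin n → BOp E}
    (hS : ∀ i j x y, inner ℂ (S i x) (S j y) = if i = j then inner ℂ x y else 0) (i j : Fin n) :
    star (S i) * S j = if i = j then 1 else 0 := by
  ext y
  refine ext_inner_left ℂ fun x => ?_
  rw [mul_apply_eq_comp, ContinuousLinearMap.star_eq_adjoint,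
    ContinuousLinearMap.adjoint_inner_right, hS]
  split_ifs <;> simp

/-- The range projections of isometries with orthogonal ranges add up to a projection. -/
theorem norm_sum_mul_star_le_one {S : Fin n → BOp E}
    (hS : ∀ i j x y, inner ℂ (S i x) (S j y) = if i = j then inner ℂ x y else 0) :
    ‖∑ i, S i * star (S i)‖ ≤ 1 := by
  refine IsStarProjection.norm_le _ ⟨?_, ?_⟩
  · change (∑ i, S i * star (S i)) * (∑ i, S i * star (S i)) = _
    rw [Finset.sum_mul_sum]
    refine Finset.sum_congr rfl fun i _ => ?_
    have : ∀ j, S i * star (S i) * (S j * star (S j))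
        = if i = j then S i * star (S j) else 0 := fun j => by
      rw [mul_assoc, ← mul_assoc (star (S i)), star_mul_of_inner hS]
      split_ifs <;> simp
    simp [this]
  · change star (∑ i, S i * star (S i)) = _
    simp [star_sum]

theorem smul_mem_opBall {S : Fin n → BOp E} (h : ‖∑ i, S i * star (S i)‖ ≤ 1) {r : ℝ}
    (h0 : 0 ≤ r) (h1 : r < 1) : (fun i => (r : ℂ) • S i) ∈ opBall n E := by
  have : ∑ i, (r : ℂ) • S i * star ((r : ℂ) • S i)
      = ((r : ℂ) * r) • ∑ i, S i * star (S i) := by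
    rw [Finset.smul_sum]
    refine Finset.sum_congr rfl fun i _ => ?_
    rw [star_smul, smul_mul_smul_comm]
    simp
  change ‖_‖ < 1
  rw [this, norm_smul, norm_mul, Complex.norm_of_nonneg h0]
  nlinarith [norm_nonneg (∑ i, S i * star (S i)), mul_nonneg h0 h0]

end Isometries

/-- The inner product space structure on the lift of an inner product space. -/
abbrev uliftInnerProductSpace (E : Type*) [NormedAddCommGroup E] [InnerProductSpace ℂ E] :
    InnerProductSpace ℂ (ULift.{v} E) where
  inner x y := inner ℂ x.down y.down
  norm_sq_eq_re_inner x := norm_sq_eq_re_inner x.down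
  conj_inner_symm x y := inner_conj_symm x.down y.down
  add_left x y z := inner_add_left x.down y.down z.down
  smul_left x y c := inner_smul_left x.down y.down c

/-- A model of the creation operators in every universe. -/
theorem exists_fock_model (n : ℕ) : ∃ (E : Type v) (_ : NormedAddCommGroup E)
    (_ : InnerProductSpace ℂ E) (_ : CompleteSpace E) (S : Fin n → BOp E)
    (e : FreeMonoid (Fin n) → E), Orthonormal ℂ e ∧ (∀ i α, S i (e α) = e (FreeMonoid.of i * α)) ∧
      ‖∑ i, S i * star (S i)‖ ≤ 1 := by
  -- The Fock space lives in `Type`, while the hypotheses on `F` range over Hilbert spaces in `Type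
  -- v`; hence the transport to a lift.
  let := uliftInnerProductSpace.{v} (FockSpace n)
  let U : ULift.{v} (FockSpace n) ≃ₗᵢ[ℂ] FockSpace n := LinearIsometryEquiv.ulift ℂ (FockSpace n)
  let S : Fin n → BOp (ULift.{v} (FockSpace n)) := fun i =>
    (U.symm : FockSpace n →L[ℂ] ULift.{v} (FockSpace n)) ∘L creation i ∘L
      (U : ULift.{v} (FockSpace n) →L[ℂ] FockSpace n)
  refine ⟨ULift.{v} (FockSpace n), inferInstance, inferInstance, inferInstance, S,
    fun α => ⟨fockBasis α⟩, ?_, fun i α => ?_, norm_sum_mul_star_le_one fun i j x y => ?_⟩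
  · classical
    rw [orthonormal_iff_ite]
    exact orthonormal_iff_ite.1 orthonormal_fockBasis
  · exact congrArg ULift.up (creation_fockBasis i α)
  · exact inner_creation i j x.down y.down

theorem re_inner_le_of_realPart_le_one {G : Type*} [NormedAddCommGroup G] [InnerProductSpace ℂ G]
    [CompleteSpace G] {L : BOp G} (h : (realPart L : BOp G) ≤ 1) (z : G) :
    (inner ℂ z (L z)).re ≤ ‖z‖ ^ 2 := by
  have h1 := (ContinuousLinearMap.le_def _ _).1 h |>.re_inner_nonneg_right z
  have h2 : (inner ℂ z ((star L) z)).re = (inner ℂ z (L z)).re := by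
    rw [ContinuousLinearMap.star_eq_adjoint, ContinuousLinearMap.adjoint_inner_right,
      ← inner_conj_symm, Complex.conj_re]
  have h3 : ((realPart L : BOp G)) z = (2⁻¹ : ℝ) • (L z + star L z) := by
    rw [realPart_apply_coe]
    rfl
  rw [sub_apply, h3, inner_sub_right, one_apply_eq_self, map_sub,
    inner_self_eq_norm_sq, inner_smul_right_eq_smul, inner_add_right, RCLike.smul_re, map_add] at h1
  simp only [RCLike.re_to_complex, h2] at h1
  linarith

/-! ### Matrix entries of the partial sums of `F(cS)` -/

section Compression

variable {n : ℕ} {H E : Type*} [NormedAddCommGroup H] [InnerProductSpace ℂ H]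
  [NormedAddCommGroup E] [InnerProductSpace ℂ E] {A : FreeMonoid (Fin n) → BOp H}
  {S : Fin n → BOp E} {e : FreeMonoid (Fin n) → E}

theorem evalWord_apply_basis (hS : ∀ i α, S i (e α) = e (FreeMonoid.of i * α))
    (α β : FreeMonoid (Fin n)) : evalWord S α (e β) = e (α * β) := by
  induction α using FreeMonoid.inductionOn' with
  | one => simp [evalWord_one]
  | of_mul i γ ih =>
    rw [evalWord_mul, mul_apply_eq_comp, ih, evalWord_of, hS, mul_assoc]

open Classical in
theorem inner_homPart (he : Orthonormal ℂ e) (hS : ∀ i α, S i (e α) = e (FreeMonoid.of i * α))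
    (c : ℂ) (m : ℕ) (β γ : FreeMonoid (Fin n)) (x y : H) :
    inner ℂ ((e γ ⊗ₜ[ℂ] y : E ⊗[ℂ] H) : HilbertTensor E H)
      (homPart A (fun i => c • S i) m ((e β ⊗ₜ[ℂ] x : E ⊗[ℂ] H) : HilbertTensor E H))
      = ∑ α ∈ words n m, if γ = α * β then c ^ m * inner ℂ y (A α x) else 0 := by
  rw [homPart, sum_apply, inner_sum]
  refine Finset.sum_congr rfl fun α hα => ?_
  rw [opTensor_tmul, inner_tmul_coe, evalWord_smul, smul_apply, evalWord_apply_basis hS,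
    inner_smul_right, orthonormal_iff_ite.1 he, mem_words.1 hα]
  split_ifs <;> simp

/-- Since `S_α e_β = e_{αβ}` and words cancel on the right, `δ` is the only word that contributes,
and it occurs in the partial sum because its length is below `N`. -/
theorem inner_partialSum_mul (he : Orthonormal ℂ e)
    (hS : ∀ i α, S i (e α) = e (FreeMonoid.of i * α)) (c : ℂ) {N : ℕ}
    (δ β : FreeMonoid (Fin n)) (hδ : δ.length < N) (x y : H) :
    inner ℂ ((e (δ * β) ⊗ₜ[ℂ] y : E ⊗[ℂ] H) : HilbertTensor E H)
      ((∑ m ∈ Finset.range N, homPart A (fun i => c • S i) m)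
        ((e β ⊗ₜ[ℂ] x : E ⊗[ℂ] H) : HilbertTensor E H))
      = c ^ δ.length * inner ℂ y (A δ x) := by
  rw [sum_apply, inner_sum, Finset.sum_eq_single δ.length]
  · rw [inner_homPart he hS, Finset.sum_eq_single δ]
    · simp
    · intro α _ hα
      rw [if_neg]
      intro h
      exact hα (mul_right_cancel h).symm
    · intro h
      exact absurd (mem_words.2 rfl) h
  · intro m _ hm
    rw [inner_homPart he hS]
    refine Finset.sum_eq_zero fun α hα => if_neg fun h => hm ?_
    rw [mul_right_cancel h, mem_words.1 hα]
  · intro h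
    exact absurd (Finset.mem_range.2 hδ) h

theorem inner_partialSum_eq_zero (he : Orthonormal ℂ e)
    (hS : ∀ i α, S i (e α) = e (FreeMonoid.of i * α)) (c : ℂ) (N : ℕ)
    {β γ : FreeMonoid (Fin n)} (h : ∀ δ, γ ≠ δ * β) (x y : H) :
    inner ℂ ((e γ ⊗ₜ[ℂ] y : E ⊗[ℂ] H) : HilbertTensor E H)
      ((∑ m ∈ Finset.range N, homPart A (fun i => c • S i) m)
        ((e β ⊗ₜ[ℂ] x : E ⊗[ℂ] H) : HilbertTensor E H)) = 0 := by
  rw [sum_apply, inner_sum]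
  refine Finset.sum_eq_zero fun m _ => ?_
  rw [inner_homPart he hS]
  exact Finset.sum_eq_zero fun α _ => if_neg (h α)

/-- The vector `e_1 ⊗ x + ∑_{|α| = k} e_α ⊗ y_α`. -/
def testVector (e : FreeMonoid (Fin n) → E) (k : ℕ) (x : H) (y : FreeMonoid (Fin n) → H) :
    HilbertTensor E H :=
  ((e 1 ⊗ₜ[ℂ] x : E ⊗[ℂ] H) : HilbertTensor E H)
    + ∑ α ∈ words n k, ((e α ⊗ₜ[ℂ] y α : E ⊗[ℂ] H) : HilbertTensor E H)

/-- Kept general in `P` so as to serve twice: `P = 1` gives the norm of the test vector, and a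
partial sum of `F(cS)` gives its quadratic form. -/
theorem inner_testVector (k : ℕ) (x : H) (y : FreeMonoid (Fin n) → H)
    (P : BOp (HilbertTensor E H)) {a : ℂ} {b : FreeMonoid (Fin n) → ℂ}
    {c : FreeMonoid (Fin n) → ℂ}
    (h11 : inner ℂ ((e 1 ⊗ₜ[ℂ] x : E ⊗[ℂ] H) : HilbertTensor E H)
      (P ((e 1 ⊗ₜ[ℂ] x : E ⊗[ℂ] H) : HilbertTensor E H)) = a)
    (h1 : ∀ α ∈ words n k, inner ℂ ((e 1 ⊗ₜ[ℂ] x : E ⊗[ℂ] H) : HilbertTensor E H)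
      (P ((e α ⊗ₜ[ℂ] y α : E ⊗[ℂ] H) : HilbertTensor E H)) = 0)
    (h2 : ∀ α ∈ words n k, inner ℂ ((e α ⊗ₜ[ℂ] y α : E ⊗[ℂ] H) : HilbertTensor E H)
      (P ((e 1 ⊗ₜ[ℂ] x : E ⊗[ℂ] H) : HilbertTensor E H)) = b α)
    (h22 : ∀ α ∈ words n k, ∀ β ∈ words n k, α ≠ β →
      inner ℂ ((e α ⊗ₜ[ℂ] y α : E ⊗[ℂ] H) : HilbertTensor E H)
      (P ((e β ⊗ₜ[ℂ] y β : E ⊗[ℂ] H) : HilbertTensor E H)) = 0)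
    (h22' : ∀ α ∈ words n k, inner ℂ ((e α ⊗ₜ[ℂ] y α : E ⊗[ℂ] H) : HilbertTensor E H)
      (P ((e α ⊗ₜ[ℂ] y α : E ⊗[ℂ] H) : HilbertTensor E H)) = c α) :
    inner ℂ (testVector e k x y) (P (testVector e k x y))
      = a + ∑ α ∈ words n k, b α + ∑ α ∈ words n k, c α := by
  rw [testVector, map_add, inner_add_left, inner_add_right, inner_add_right, h11, map_sum,
    inner_sum, Finset.sum_eq_zero h1, sum_inner, Finset.sum_congr rfl h2, sum_inner, add_zero,
    add_assoc]
  congr 2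
  refine Finset.sum_congr rfl fun α hα => ?_
  rw [inner_sum, Finset.sum_eq_single_of_mem α hα fun β hβ h => h22 α hα β hβ h.symm, h22' α hα]

theorem norm_testVector_sq (he : Orthonormal ℂ e) {k : ℕ} (hk : 1 ≤ k) (x : H)
    (y : FreeMonoid (Fin n) → H) :
    ‖testVector e k x y‖ ^ 2 = ‖x‖ ^ 2 + ∑ α ∈ words n k, ‖y α‖ ^ 2 := by
  have hne : ∀ α ∈ words n k, α ≠ 1 := by
    rintro α hα rfl
    rw [mem_words, FreeMonoid.length_one] at hα
    omega
  classical
  have h := inner_testVector (e := e) k x y (1 : BOp (HilbertTensor E H))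
    (a := (‖x‖ : ℂ) ^ 2) (b := 0) (c := fun α => (‖y α‖ : ℂ) ^ 2)
    (by simp [he.norm_eq_one])
    (fun α hα => by
      simp [-UniformSpace.Completion.inner_coe, inner_tmul_coe,
        orthonormal_iff_ite.1 he, (hne α hα).symm])
    (fun α hα => by
      simp [-UniformSpace.Completion.inner_coe, inner_tmul_coe,
        orthonormal_iff_ite.1 he, hne α hα])
    (fun α _ β _ h => by
      simp [-UniformSpace.Completion.inner_coe, inner_tmul_coe, orthonormal_iff_ite.1 he, h])
    (fun α _ => by simp [he.norm_eq_one])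
  rw [one_apply_eq_self, inner_self_eq_norm_sq_to_K] at h
  simp only [Pi.zero_apply, Finset.sum_const_zero, add_zero] at h
  exact Complex.ofReal_injective (by push_cast; exact h)

theorem inner_partialSum_testVector (he : Orthonormal ℂ e)
    (hS : ∀ i α, S i (e α) = e (FreeMonoid.of i * α)) (c : ℂ) {k N : ℕ} (hk : 1 ≤ k) (hN : k < N)
    (x : H) (y : FreeMonoid (Fin n) → H) :
    inner ℂ (testVector e k x y)
      ((∑ m ∈ Finset.range N, homPart A (fun i => c • S i) m) (testVector e k x y))
      = inner ℂ x (A 1 x) + ∑ α ∈ words n k, c ^ k * inner ℂ (y α) (A α x)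
        + ∑ α ∈ words n k, inner ℂ (y α) (A 1 (y α)) := by
  have hdiag : ∀ β : FreeMonoid (Fin n), ∀ z : H,
      inner ℂ ((e β ⊗ₜ[ℂ] z : E ⊗[ℂ] H) : HilbertTensor E H)
        ((∑ m ∈ Finset.range N, homPart A (fun i => c • S i) m)
          ((e β ⊗ₜ[ℂ] z : E ⊗[ℂ] H) : HilbertTensor E H)) = inner ℂ z (A 1 z) := fun β z => by
    simpa using inner_partialSum_mul (A := A) he hS c (N := N) 1 β (by simp; omega) z z
  refine inner_testVector k x y _ (hdiag 1 x) (fun α hα => ?_) (fun α hα => ?_)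
    (fun α hα β hβ h => ?_) fun α _ => hdiag α (y α)
  · refine inner_partialSum_eq_zero he hS c N (fun δ h => ?_) _ _
    have := congrArg FreeMonoid.length h
    rw [FreeMonoid.length_one, FreeMonoid.length_mul, mem_words.1 hα] at this
    omega
  · have h := inner_partialSum_mul (A := A) he hS c (N := N) α 1
      (by rw [mem_words.1 hα]; exact hN) x (y α)
    rwa [mul_one, mem_words.1 hα] at h
  -- Two words of equal length with `α = δβ` coincide, so distinct words of length `k` do not
  -- interact.
  · refine inner_partialSum_eq_zero he hS c N (fun δ hδ => h ?_) _ _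
    have := congrArg FreeMonoid.length hδ
    rw [FreeMonoid.length_mul, mem_words.1 hα, mem_words.1 hβ] at this
    rw [hδ, FreeMonoid.length_eq_zero.1 (by omega : δ.length = 0), one_mul]

end Compression

/-! ### The fundamental inequality for the coefficients -/

section Coefficients

variable {n : ℕ} {H : Type u} [NormedAddCommGroup H] [InnerProductSpace ℂ H]
  {A : FreeMonoid (Fin n) → BOp H}

theorem re_inner_coeff_le_of_lt_one (hF : IsHolomorphicOnBall.{v, u} A)
    (hRe : ReLeOneOnBall.{v, u} A) {k : ℕ} (hk : 1 ≤ k) (x : H) (y : FreeMonoid (Fin n) → H)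
    {r : ℝ} (h0 : 0 ≤ r) (h1 : r < 1) :
    r ^ k * ∑ α ∈ words n k, (inner ℂ (y α) (A α x)).re
      ≤ (inner ℂ x ((1 - A 1) x)).re
        + ∑ α ∈ words n k, (inner ℂ (y α) ((1 - A 1) (y α))).re := by
  obtain ⟨E, _, _, _, S, e, he, hS, hb⟩ := exists_fock_model.{v} n
  have hX := smul_mem_opBall hb h0 h1
  obtain ⟨L, hL⟩ := hF E _ hX
  have h2 := re_inner_le_of_realPart_le_one (hRe E _ hX L hL) (testVector e k x y)
  rw [norm_testVector_sq he hk] at h2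
  have h3 : Filter.Tendsto (fun N => inner ℂ (testVector e k x y)
      ((∑ m ∈ Finset.range N, homPart A (fun i => (r : ℂ) • S i) m) (testVector e k x y)))
      Filter.atTop (𝓝 (inner ℂ (testVector e k x y) (L (testVector e k x y)))) := by
    have hc : Continuous fun P : BOp (HilbertTensor E H) =>
      inner ℂ (testVector e k x y) (P (testVector e k x y)) := by fun_prop
    exact (hc.tendsto L).comp hL
  -- The quadratic form of the partial sums at the test vector is constant once `N > k`, so the
  -- limit is known exactly.
  have h4 := tendsto_nhds_unique h3 (tendsto_const_nhds.congr' (by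
    filter_upwards [Filter.eventually_gt_atTop k] with N hN
    exact (inner_partialSum_testVector he hS (r : ℂ) hk hN x y).symm))
  rw [h4] at h2
  simp only [Complex.add_re, Complex.re_sum, ← Complex.ofReal_pow, Complex.re_ofReal_mul,
    ← Finset.mul_sum] at h2
  have h5 : ∀ z : H, (inner ℂ z ((1 - A 1) z)).re = ‖z‖ ^ 2 - (inner ℂ z (A 1 z)).re := fun z => by
    rw [sub_apply, one_apply_eq_self, inner_sub_right, Complex.sub_re]
    congr 1
    exact inner_self_eq_norm_sq (𝕜 := ℂ) z
  simp only [h5, Finset.sum_sub_distrib]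
  linarith

/-- The positivity of the Toeplitz kernel of `I - F`, compressed to the words of length `0` and
`k`. -/
theorem re_inner_coeff_le (hF : IsHolomorphicOnBall.{v, u} A)
    (hRe : ReLeOneOnBall.{v, u} A) {k : ℕ} (hk : 1 ≤ k) (x : H) (y : FreeMonoid (Fin n) → H) :
    ∑ α ∈ words n k, (inner ℂ (y α) (A α x)).re
      ≤ (inner ℂ x ((1 - A 1) x)).re
        + ∑ α ∈ words n k, (inner ℂ (y α) ((1 - A 1) (y α))).re := by
  have h : Filter.Tendsto
      (fun r : ℝ => r ^ k * ∑ α ∈ words n k, (inner ℂ (y α) (A α x)).re) (𝓝[<] 1)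
      (𝓝 (1 ^ k * ∑ α ∈ words n k, (inner ℂ (y α) (A α x)).re)) :=
    ((by fun_prop : Continuous fun r : ℝ => r ^ k *
      ∑ α ∈ words n k, (inner ℂ (y α) (A α x)).re).tendsto 1).mono_left nhdsWithin_le_nhds
  rw [one_pow, one_mul] at h
  refine le_of_tendsto h ?_
  filter_upwards [Ioo_mem_nhdsLT (zero_lt_one (α := ℝ))] with r hr
  exact re_inner_coeff_le_of_lt_one hF hRe hk x y hr.1.le hr.2

theorem hasValue_zero {E : Type*} [NormedAddCommGroup E] [InnerProductSpace ℂ E] :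
    HasValue A (0 : Fin n → BOp E) (opTensor 1 (A 1)) := by
  refine tendsto_const_nhds.congr' ?_
  filter_upwards [Filter.eventually_ge_atTop 1] with N hN
  rw [Finset.sum_eq_single_of_mem 0 (Finset.mem_range.2 hN)]
  · simp [homPart, words_zero, evalWord_one]
  · intro k _ hk
    obtain ⟨m, rfl⟩ := Nat.exists_eq_succ_of_ne_zero hk
    rw [homPart, Nat.succ_eq_add_one, sum_words_succ]
    refine Finset.sum_eq_zero fun β _ => Finset.sum_eq_zero fun i _ => ?_
    rw [evalWord_mul, evalWord_of, Pi.zero_apply, zero_mul, opTensor_zero_left]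

theorem coeff_one_nonneg (hF0 : NonnegAtZero.{v, u} A) : 0 ≤ A 1 := by
  -- Only a unit vector `e 1` in some Hilbert space of universe `v` is needed here: `F(0) = 1 ⊗ A 1`
  -- is tested on `e 1 ⊗ x`.
  obtain ⟨E, _, _, _, S, e, he, -⟩ := exists_fock_model.{v} n
  have h := (ContinuousLinearMap.nonneg_iff_isPositive _).1 (hF0 E _ hasValue_zero)
  rw [ContinuousLinearMap.nonneg_iff_isPositive, ContinuousLinearMap.isPositive_iff_complex]
  intro x
  have h1 := h.inner_nonneg_left ((e 1 ⊗ₜ[ℂ] x : E ⊗[ℂ] H) : HilbertTensor E H)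
  rw [opTensor_tmul, inner_tmul_coe, one_apply_eq_self, inner_self_eq_norm_sq_to_K, he.norm_eq_one,
    RCLike.ofReal_one, one_pow, one_mul, Complex.le_def] at h1
  refine ⟨?_, h1.1⟩
  exact Complex.ext rfl h1.2

theorem coeff_one_le_one (hF : IsHolomorphicOnBall.{v, u} A) (hF0 : NonnegAtZero.{v, u} A)
    (hRe : ReLeOneOnBall.{v, u} A) : A 1 ≤ 1 := by
  have hsymm := ContinuousLinearMap.isPositive_one.isSymmetric.sub
    ((ContinuousLinearMap.nonneg_iff_isPositive _).1 (coeff_one_nonneg hF0)).isSymmetric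
  refine (ContinuousLinearMap.le_def _ _).2 ⟨hsymm, fun x => ?_⟩
  -- With `y = 0` only the diagonal entry at the empty word survives.
  have h := re_inner_coeff_le hF hRe le_rfl x 0
  simp only [Pi.zero_apply, inner_zero_left, Complex.zero_re, Finset.sum_const_zero,
    add_zero] at h
  have h2 := hsymm x x
  rw [ContinuousLinearMap.reApplyInnerSelf_apply]
  exact h.trans_eq (congrArg Complex.re h2.symm)

end Coefficients

/-! ### Operator inequalities from a dominated column -/

section Column

variable {ι H : Type*} [NormedAddCommGroup H] [InnerProductSpace ℂ H]

/-- The operator matrix with the blocks `2B` on the diagonal and the operators `C_i` in the first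
column off the diagonal is positive. -/
def IsDominated (s : Finset ι) (C : ι → BOp H) (B : BOp H) : Prop :=
  ∀ (x : H) (y : ι → H), ∑ i ∈ s, (inner ℂ (y i) (C i x)).re
    ≤ (inner ℂ x (B x)).re + ∑ i ∈ s, (inner ℂ (y i) (B (y i))).re

variable {s : Finset ι} {C : ι → BOp H} {B : BOp H}

theorem re_inner_nonneg {P : BOp H} (hP : 0 ≤ P) (x : H) : 0 ≤ (inner ℂ x (P x)).re :=
  ((ContinuousLinearMap.nonneg_iff_isPositive P).1 hP).re_inner_nonneg_right x

theorem re_inner_le_norm_mul_sq (P : BOp H) (x : H) :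
    (inner ℂ x (P x)).re ≤ ‖P‖ * ‖x‖ ^ 2 :=
  (Complex.re_le_norm _).trans <| (norm_inner_le_norm _ _).trans <| by
    have := mul_le_mul_of_nonneg_left (P.le_opNorm x) (norm_nonneg x)
    linarith

/-- Testing the positivity of the operator matrix on the vectors `t y`. -/
theorem IsDominated.mul_le (h : IsDominated s C B) (x : H) (y : ι → H) (t : ℝ) :
    t * ∑ i ∈ s, (inner ℂ (y i) (C i x)).re
      ≤ (inner ℂ x (B x)).re + t ^ 2 * ∑ i ∈ s, (inner ℂ (y i) (B (y i))).re := by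
  have := h x fun i => (t : ℂ) • y i
  simp only [map_smul, inner_smul_left, inner_smul_right, Complex.conj_ofReal,
    Complex.re_ofReal_mul, ← Finset.mul_sum] at this
  linarith

variable [CompleteSpace H]

theorem le_of_re_inner_le {P Q : BOp H} (hP : IsSelfAdjoint P) (hQ : IsSelfAdjoint Q)
    (h : ∀ x, (inner ℂ x (P x)).re ≤ (inner ℂ x (Q x)).re) : P ≤ Q := by
  rw [ContinuousLinearMap.le_def, ContinuousLinearMap.isPositive_def']
  refine ⟨hQ.sub hP, fun x => ?_⟩
  rw [ContinuousLinearMap.reApplyInnerSelf_apply, inner_re_symm, sub_apply, inner_sub_right,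
    map_sub]
  exact sub_nonneg.2 (h x)

theorem re_inner_star_mul_mul (P Q : BOp H) (x : H) :
    (inner ℂ x ((star P * Q * P) x)).re = (inner ℂ (P x) (Q (P x))).re := by
  rw [mul_assoc, mul_apply_eq_comp, ContinuousLinearMap.star_eq_adjoint,
    ContinuousLinearMap.adjoint_inner_right, mul_apply_eq_comp]

theorem re_inner_star_mul_self (P : BOp H) (x : H) :
    (inner ℂ x ((star P * P) x)).re = ‖P x‖ ^ 2 := by
  rw [mul_apply_eq_comp, ContinuousLinearMap.star_eq_adjoint,
    ContinuousLinearMap.adjoint_inner_right]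
  exact inner_self_eq_norm_sq (𝕜 := ℂ) (P x)

/-- Test with `y_i = t C_i x`, bound `B` by `‖B‖` in the quadratic term and optimise over `t`. The
factor `‖B‖` is retained because the norm estimate `2‖1 - A 1‖` depends on it. -/
theorem IsDominated.sum_star_mul_self_le (hB : 0 ≤ B) (h : IsDominated s C B) :
    ∑ i ∈ s, star (C i) * C i ≤ (4 * ‖B‖) • B := by
  refine le_of_re_inner_le (isSelfAdjoint_sum _ fun i _ => IsSelfAdjoint.star_mul_self _)
    ((IsSelfAdjoint.all _).smul (IsSelfAdjoint.of_nonneg hB)) fun x => ?_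
  rw [sum_apply, inner_sum, Complex.re_sum, smul_apply, inner_smul_right_eq_smul,
    Complex.smul_re, smul_eq_mul]
  simp only [re_inner_star_mul_self]
  set σ := ∑ i ∈ s, ‖C i x‖ ^ 2
  have hq := re_inner_nonneg hB x
  set q := (inner ℂ x (B x)).re
  have key : ∀ t : ℝ, t * σ ≤ q + t ^ 2 * (‖B‖ * σ) := fun t => by
    have h1 := h.mul_le x (fun i => C i x) t
    have h2 : ∑ i ∈ s, (inner ℂ (C i x) (B (C i x))).re ≤ ‖B‖ * σ := by
      rw [Finset.mul_sum]
      exact Finset.sum_le_sum fun i _ => re_inner_le_norm_mul_sq B _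
    have h3 : ∑ i ∈ s, (inner ℂ (C i x) (C i x)).re = σ :=
      Finset.sum_congr rfl fun i _ => inner_self_eq_norm_sq (𝕜 := ℂ) (C i x)
    rw [h3] at h1
    exact h1.trans (by gcongr)
  -- For `B = 0` the inequality at `t = 1` already reads `σ ≤ 0`; otherwise `t = 1 / (2‖B‖)`
  -- maximises `tσ - t²‖B‖σ`.
  rcases (norm_nonneg B).eq_or_lt with h0 | h0
  · have hB0 : B = 0 := norm_eq_zero.1 h0.symm
    have hq0 : q = 0 := by simp [q, hB0]
    have := key 1
    rw [← h0, hq0] at this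
    rw [← h0]
    linarith
  · have := key (1 / (2 * ‖B‖))
    have h4 : (1 / (2 * ‖B‖)) ^ 2 * (‖B‖ * σ) = σ / (4 * ‖B‖) := by
      field_simp
      ring
    have h5 : 1 / (2 * ‖B‖) * σ = 2 * (σ / (4 * ‖B‖)) := by
      field_simp
      ring
    rw [h4, h5] at this
    have h6 : σ / (4 * ‖B‖) ≤ q := by linarith
    rw [div_le_iff₀ (by positivity)] at h6
    linarith

theorem IsDominated.sum_star_mul_inverse_mul_le (hB : 0 ≤ B) (hu : IsUnit B)
    (h : IsDominated s C B) :
    ∑ i ∈ s, star (C i) * Ring.inverse B * C i ≤ (4 : ℝ) • B := by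
  have hi : 0 ≤ Ring.inverse B := (CFC.ringInverse_nonneg_iff_nonneg_of_isUnit hu).2 hB
  refine le_of_re_inner_le (isSelfAdjoint_sum _ fun i _ =>
    IsSelfAdjoint.of_nonneg (star_left_conjugate_nonneg hi _))
    ((IsSelfAdjoint.all _).smul (IsSelfAdjoint.of_nonneg hB)) fun x => ?_
  rw [sum_apply, inner_sum, Complex.re_sum, smul_apply, inner_smul_right_eq_smul,
    Complex.smul_re, smul_eq_mul]
  simp only [re_inner_star_mul_mul]
  -- With `y_i = t B⁻¹ C_i x` both sums become `∑ ⟪C_i x, B⁻¹ C_i x⟫`, and `t - t²` is largest,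
  -- equal to `1/4`, at `t = 1/2`.
  have h1 := h.mul_le x (fun i => Ring.inverse B (C i x)) (1 / 2)
  have h2 : ∀ z, B (Ring.inverse B z) = z := fun z => by
    rw [← mul_apply_eq_comp, Ring.mul_inverse_cancel _ hu, one_apply_eq_self]
  simp only [h2] at h1
  have h3 : ∀ z, (inner ℂ (Ring.inverse B z) z).re = (inner ℂ z (Ring.inverse B z)).re :=
    fun z => inner_re_symm (𝕜 := ℂ) _ _
  simp only [h3] at h1
  linarith

end Column

/-! ### Geometric series of operators -/

section Geometric

theorem hasSum_pow_succ {r : ℝ} (h0 : 0 ≤ r) (h1 : r < 1) :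
    HasSum (fun k : ℕ => r ^ (k + 1)) (r / (1 - r)) := by
  simpa only [pow_succ', div_eq_mul_inv] using (hasSum_geometric_of_lt_one h0 h1).mul_left r

variable {H : Type*} [NormedAddCommGroup H] [InnerProductSpace ℂ H] [CompleteSpace H]

/-- A power series whose coefficients lie between `0` and a fixed operator. -/
theorem summable_and_tsum_pow_smul_le {r : ℝ} (h0 : 0 ≤ r) (h1 : r < 1) {Q : ℕ → BOp H} {P : BOp H}
    (hQ : ∀ k, 0 ≤ Q k) (hP : ∀ k, Q k ≤ P) :
    Summable (fun k => r ^ (k + 1) • Q k) ∧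
      ∑' k, r ^ (k + 1) • Q k ≤ (r / (1 - r)) • P := by
  have hs : Summable fun k => r ^ (k + 1) • Q k := by
    refine Summable.of_norm_bounded (g := fun k => r ^ (k + 1) * ‖P‖)
      ((hasSum_pow_succ h0 h1).summable.mul_right _) fun k => ?_
    rw [norm_smul, Real.norm_of_nonneg (by positivity)]
    gcongr
    exact CStarAlgebra.norm_le_norm_of_nonneg_of_le (hQ k) (hP k)
  have hg := (hasSum_pow_succ h0 h1).smul_const P
  refine ⟨hs, ?_⟩
  rw [← hg.tsum_eq]
  exact hs.tsum_le_tsum (fun k => smul_le_smul_of_nonneg_left (hP k) (by positivity)) hg.summable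

end Geometric

/-! ### Bohr-type inequalities for the coefficients -/

section Consequences

variable {n : ℕ} {H : Type*} [NormedAddCommGroup H] [InnerProductSpace ℂ H] [CompleteSpace H]
  {A : FreeMonoid (Fin n) → BOp H}

theorem coeffSq_nonneg (k : ℕ) : 0 ≤ coeffSq A k :=
  Finset.sum_nonneg fun _ _ => star_mul_self_nonneg _

theorem coeffSq_zero : coeffSq A 0 = star (A 1) * A 1 := by
  rw [coeffSq, words_zero, Finset.sum_singleton]

theorem sqrt_norm_coeffSq_zero : √‖coeffSq A 0‖ = ‖A 1‖ := by
  rw [coeffSq_zero, CStarRing.norm_star_mul_self, Real.sqrt_mul_self (norm_nonneg _)]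

theorem norm_one_sub_le_one (h0 : 0 ≤ A 1) (h1 : A 1 ≤ 1) : ‖1 - A 1‖ ≤ 1 := by
  refine (CStarAlgebra.norm_le_norm_of_nonneg_of_le (sub_nonneg.2 h1)
    (sub_le_self 1 h0)).trans ?_
  -- Only `‖1‖ ≤ 1` is available, since `H` may be zero.
  exact ContinuousLinearMap.norm_id_le

theorem coeffSq_le (h0 : 0 ≤ A 1) (h1 : A 1 ≤ 1) {k : ℕ}
    (h : IsDominated (words n k) A (1 - A 1)) : coeffSq A k ≤ (4 : ℝ) • (1 - A 1) := by
  refine (h.sum_star_mul_self_le (sub_nonneg.2 h1)).trans ?_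
  refine smul_le_smul_of_nonneg_right ?_ (sub_nonneg.2 h1)
  linarith [norm_one_sub_le_one h0 h1]

theorem sqrt_norm_coeffSq_le (h1 : A 1 ≤ 1) {k : ℕ}
    (h : IsDominated (words n k) A (1 - A 1)) : √‖coeffSq A k‖ ≤ 2 * ‖1 - A 1‖ := by
  rw [Real.sqrt_le_left (by positivity)]
  refine (CStarAlgebra.norm_le_norm_of_nonneg_of_le (coeffSq_nonneg (A := A) k)
    (h.sum_star_mul_self_le (sub_nonneg.2 h1))).trans ?_
  rw [norm_smul, Real.norm_of_nonneg (by positivity)]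
  exact le_of_eq (by ring)

theorem sqrt_coeffSq_zero (h0 : 0 ≤ A 1) : CFC.sqrt (coeffSq A 0) = A 1 := by
  rw [coeffSq_zero, (IsSelfAdjoint.of_nonneg h0).star_eq, CFC.sqrt_mul_self _ h0]

/-- The square root is operator monotone, so it may be applied to `coeffSq A k ≤ 4 (1 - A 1)`. -/
theorem sqrt_coeffSq_le (h0 : 0 ≤ A 1) (h1 : A 1 ≤ 1) {k : ℕ}
    (h : IsDominated (words n k) A (1 - A 1)) :
    CFC.sqrt (coeffSq A k) ≤ (2 : ℝ) • CFC.sqrt (1 - A 1) := by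
  refine (CFC.sqrt_le_sqrt _ _ (coeffSq_le h0 h1 h)).trans_eq ?_
  have hR : 0 ≤ CFC.sqrt (1 - A 1) := CFC.sqrt_nonneg _
  refine CFC.sqrt_unique ?_ (smul_nonneg zero_le_two hR)
  have hs : CFC.sqrt (1 - A 1) * CFC.sqrt (1 - A 1) = 1 - A 1 :=
    CFC.sqrt_mul_sqrt_self _ (sub_nonneg.2 h1)
  rw [smul_mul_smul_comm, hs]
  norm_num

/-- With `t = r / (1 - r)` and `R = √(1 - a)`, the left side is the polynomial `1 - R² + 2tR` in `0
≤ R ≤ 1`. Its maximum over `[0, 1]` is at `R = t` when `t ≤ 1`, that is `r ≤ 1/2`, and at `R = 1`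
otherwise; this is the case distinction in `M`. -/
theorem add_smul_sqrt_le_M {a : BOp H} (h0 : 0 ≤ a) (h1 : a ≤ 1) {r : ℝ} (hr1 : r < 1) :
    a + (r / (1 - r)) • (2 : ℝ) • CFC.sqrt (1 - a) ≤ M r • (1 : BOp H) := by
  set R := CFC.sqrt (1 - a)
  have hR : 0 ≤ R := CFC.sqrt_nonneg _
  have hRR : R * R = 1 - a := CFC.sqrt_mul_sqrt_self _ (sub_nonneg.2 h1)
  have hR1 : R ≤ 1 := by
    have := CFC.sqrt_le_sqrt (1 - a) 1 (sub_le_self 1 h0)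
    rwa [CFC.sqrt_one] at this
  have ha : a = 1 - R * R := by rw [hRR, sub_sub_cancel]
  rw [ha, M]
  have h1r : 0 < 1 - r := sub_pos.2 hr1
  split_ifs with hr
  -- The difference of the two sides is `(t - R)²`.
  · have h := (((IsSelfAdjoint.all (r / (1 - r))).smul (IsSelfAdjoint.one (BOp H))).sub
      (IsSelfAdjoint.of_nonneg hR)).mul_self_nonneg
    rw [← sub_nonneg]
    refine h.trans_eq ?_
    rw [← div_pow]
    simp only [sub_mul, mul_sub, smul_mul_assoc, mul_smul_comm, one_mul, mul_one]
    module
  -- The difference of the two sides is `(1 - R)² + (2t - 2)(1 - R)`.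
  · have h := (IsSelfAdjoint.of_nonneg (sub_nonneg.2 hR1)).mul_self_nonneg
    have hc : 0 ≤ 2 * (r / (1 - r)) - 2 := by
      rw [sub_nonneg, ← mul_div_assoc, le_div_iff₀ h1r]
      linarith
    have h' := add_nonneg h (smul_nonneg hc (sub_nonneg.2 hR1))
    rw [← sub_nonneg]
    refine h'.trans_eq ?_
    rw [mul_div_assoc]
    simp only [sub_mul, mul_sub, one_mul, mul_one]
    module

theorem summable_and_tsum_sqrt_coeffSq_le (h0 : 0 ≤ A 1) (h1 : A 1 ≤ 1)
    (h : ∀ k, 1 ≤ k → IsDominated (words n k) A (1 - A 1)) {r : ℝ} (hr0 : 0 ≤ r) (hr1 : r < 1) :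
    Summable (fun k : ℕ => r ^ k • CFC.sqrt (coeffSq A k)) ∧
      ∑' k : ℕ, r ^ k • CFC.sqrt (coeffSq A k) ≤ M r • (1 : BOp H) := by
  obtain ⟨hs, ht⟩ := summable_and_tsum_pow_smul_le hr0 hr1
    (Q := fun k => CFC.sqrt (coeffSq A (k + 1))) (fun k => CFC.sqrt_nonneg _)
    fun k => sqrt_coeffSq_le h0 h1 (h (k + 1) (by omega))
  have hs' := (summable_nat_add_iff (f := fun k : ℕ => r ^ k • CFC.sqrt (coeffSq A k)) 1).1 hs
  refine ⟨hs', ?_⟩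
  rw [hs'.tsum_eq_zero_add, pow_zero, one_smul, sqrt_coeffSq_zero h0]
  exact (add_le_add_right ht _).trans (add_smul_sqrt_le_M h0 h1 hr1)

theorem summable_and_tsum_inverse_le (h0 : 0 ≤ A 1) (h1 : A 1 ≤ 1)
    (h : ∀ k, 1 ≤ k → IsDominated (words n k) A (1 - A 1)) (hu : IsUnit (1 - A 1))
    {r : ℝ} (hr0 : 0 ≤ r) (hr1 : r < 1) :
    Summable (fun k : ℕ => ∑ α ∈ words n (k + 1),
        r ^ (k + 1) • (star (A α) * Ring.inverse (1 - A 1) * A α)) ∧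
      A 1 + ∑' k : ℕ, ∑ α ∈ words n (k + 1),
        r ^ (k + 1) • (star (A α) * Ring.inverse (1 - A 1) * A α) ≤ K r • (1 : BOp H) := by
  have hi : 0 ≤ Ring.inverse (1 - A 1) :=
    (CFC.ringInverse_nonneg_iff_nonneg_of_isUnit hu).2 (sub_nonneg.2 h1)
  obtain ⟨hs, ht⟩ := summable_and_tsum_pow_smul_le hr0 hr1
    (Q := fun k => ∑ α ∈ words n (k + 1), star (A α) * Ring.inverse (1 - A 1) * A α)
    (fun k => Finset.sum_nonneg fun α _ => star_left_conjugate_nonneg hi _)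
    fun k => (h (k + 1) (by omega)).sum_star_mul_inverse_mul_le (sub_nonneg.2 h1) hu
  simp only [← Finset.smul_sum]
  refine ⟨hs, (add_le_add_right ht _).trans ?_⟩
  have h1r : 0 < 1 - r := sub_pos.2 hr1
  rw [K, mul_div_assoc]
  -- With `t = r / (1 - r)`, the bound `A 1 + 4t (1 - A 1)` falls short of `1` by `(1 - 4t)(1 - A
  -- 1)` and of `4t` by `(4t - 1) A 1`; the sign of `1 - 4t` changes at `r = 1/5`.
  split_ifs with hr
  · have hc : 0 ≤ 1 - 4 * (r / (1 - r)) := by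
      rw [sub_nonneg, ← mul_div_assoc, div_le_one h1r]
      linarith
    rw [← sub_nonneg]
    refine (smul_nonneg hc (sub_nonneg.2 h1)).trans_eq ?_
    module
  · have hc : 0 ≤ 4 * (r / (1 - r)) - 1 := by
      rw [sub_nonneg, ← mul_div_assoc, le_div_iff₀ h1r]
      linarith
    rw [← sub_nonneg]
    refine (smul_nonneg hc h0).trans_eq ?_
    module

theorem summable_and_tsum_sqrt_norm_coeffSq_le (h1 : A 1 ≤ 1)
    (h : ∀ k, 1 ≤ k → IsDominated (words n k) A (1 - A 1)) {r : ℝ} (hr0 : 0 ≤ r)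
    (hr1 : r ≤ 1 / 3) :
    Summable (fun k : ℕ => r ^ k * √‖coeffSq A k‖) ∧
      ∑' k : ℕ, r ^ k * √‖coeffSq A k‖ ≤ ‖A 1‖ + ‖1 - A 1‖ := by
  have hg := (hasSum_pow_succ hr0 (by linarith)).mul_right (2 * ‖1 - A 1‖)
  have hle : ∀ k : ℕ, r ^ (k + 1) * √‖coeffSq A (k + 1)‖ ≤ r ^ (k + 1) * (2 * ‖1 - A 1‖) :=
    fun k => mul_le_mul_of_nonneg_left (sqrt_norm_coeffSq_le h1 (h (k + 1) (by omega)))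
      (by positivity)
  have hs := Summable.of_nonneg_of_le (fun k => by positivity) hle hg.summable
  have hs' := (summable_nat_add_iff (f := fun k : ℕ => r ^ k * √‖coeffSq A k‖) 1).1 hs
  refine ⟨hs', ?_⟩
  rw [hs'.tsum_eq_zero_add, pow_zero, one_mul, sqrt_norm_coeffSq_zero]
  gcongr
  refine (hs.tsum_le_tsum hle hg.summable).trans ?_
  rw [hg.tsum_eq]
  have : r / (1 - r) ≤ 1 / 2 := by
    rw [div_le_iff₀ (by linarith)]
    linarith
  nlinarith [norm_nonneg (1 - A 1)]

end Consequences

/-! ### Row contractions and their words -/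

section Row

variable {n : ℕ} {E : Type*} [NormedAddCommGroup E] [InnerProductSpace ℂ E]

theorem sum_norm_sq_evalWord_le {Y : Fin n → BOp E} {q : ℝ} (hq : 0 ≤ q)
    (h : ∀ x, ∑ i, ‖Y i x‖ ^ 2 ≤ q * ‖x‖ ^ 2) (k : ℕ) (x : E) :
    ∑ α ∈ words n k, ‖evalWord Y α x‖ ^ 2 ≤ q ^ k * ‖x‖ ^ 2 := by
  induction k with
  | zero => simp [words_zero, evalWord_one]
  | succ k ih =>
    rw [sum_words_succ]
    calc ∑ β ∈ words n k, ∑ i, ‖evalWord Y (FreeMonoid.of i * β) x‖ ^ 2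
        ≤ ∑ β ∈ words n k, q * ‖evalWord Y β x‖ ^ 2 := Finset.sum_le_sum fun β _ => by
          simpa only [evalWord_mul, evalWord_of, mul_apply_eq_comp] using h (evalWord Y β x)
      _ ≤ q * (q ^ k * ‖x‖ ^ 2) := by
          rw [← Finset.mul_sum]
          gcongr
      _ = q ^ (k + 1) * ‖x‖ ^ 2 := by ring

variable [CompleteSpace E]

/-- The row of the `Y_i^*` is the adjoint of the column of the `Y_i`, so the latter has the same
norm bound. -/
theorem sum_norm_sq_le_of_norm_rowOp_le {Y : Fin n → BOp E} {ρ : ℝ}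
    (h : ‖rowOp (fun i => star (Y i))‖ ≤ ρ) (x : E) :
    ∑ i, ‖Y i x‖ ^ 2 ≤ ρ ^ 2 * ‖x‖ ^ 2 := by
  have hρ : 0 ≤ ρ := (ContinuousLinearMap.opNorm_nonneg _).trans h
  let v : PiLp 2 (fun _ : Fin n => E) := WithLp.toLp 2 fun i => Y i x
  have hv : ‖v‖ ^ 2 = ∑ i, ‖Y i x‖ ^ 2 := PiLp.norm_sq_eq_of_L2 _ v
  have h1 : ‖v‖ ^ 2 = (inner ℂ x (rowOp (fun i => star (Y i)) v)).re := by
    rw [hv, rowOp, sum_apply, inner_sum, Complex.re_sum]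
    exact Finset.sum_congr rfl fun i _ => (re_inner_star_mul_self (Y i) x).symm
  have h2 : ‖v‖ ^ 2 ≤ ‖x‖ * (ρ * ‖v‖) := by
    rw [h1]
    refine (Complex.re_le_norm _).trans ((norm_inner_le_norm _ _).trans ?_)
    gcongr
    exact (ContinuousLinearMap.le_opNorm _ _).trans (by gcongr)
  have h3 : ‖v‖ ≤ ρ * ‖x‖ := by
    rcases (norm_nonneg v).eq_or_lt with h0 | h0
    · rw [← h0]
      positivity
    · nlinarith
  rw [← hv, ← mul_pow]
  gcongr

theorem norm_sum_star_mul_self_le {ι : Type*} {s : Finset ι} {C : ι → BOp E} {q : ℝ} (hq : 0 ≤ q)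
    (h : ∀ x, ∑ i ∈ s, ‖C i x‖ ^ 2 ≤ q * ‖x‖ ^ 2) : ‖∑ i ∈ s, star (C i) * C i‖ ≤ q := by
  have h1 : ∑ i ∈ s, star (C i) * C i ≤ q • (1 : BOp E) := by
    refine le_of_re_inner_le (isSelfAdjoint_sum _ fun i _ => IsSelfAdjoint.star_mul_self _)
      ((IsSelfAdjoint.all _).smul (IsSelfAdjoint.one _)) fun x => ?_
    rw [sum_apply, inner_sum, Complex.re_sum, smul_apply, inner_smul_right_eq_smul,
      Complex.smul_re, smul_eq_mul, one_apply_eq_self]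
    simp only [re_inner_star_mul_self]
    exact (h x).trans_eq (congrArg (q * ·) (inner_self_eq_norm_sq (𝕜 := ℂ) x).symm)
  have h0 : 0 ≤ ∑ i ∈ s, star (C i) * C i := Finset.sum_nonneg fun _ _ => star_mul_self_nonneg _
  refine (CStarAlgebra.norm_le_norm_of_nonneg_of_le h0 h1).trans ?_
  rw [norm_smul, Real.norm_of_nonneg hq]
  exact mul_le_of_le_one_right hq ContinuousLinearMap.norm_id_le

end Row

/-! ### Homogeneous sums in `S_i ⊗ Y_i` -/

section WordTensor

variable {n : ℕ} {E F : Type*} [NormedAddCommGroup E] [InnerProductSpace ℂ E]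
  [NormedAddCommGroup F] [InnerProductSpace ℂ F]

theorem evalWord_opTensor (S : Fin n → BOp E) (Y : Fin n → BOp F) (α : FreeMonoid (Fin n)) :
    evalWord (fun i => opTensor (S i) (Y i)) α = opTensor (evalWord S α) (evalWord Y α) := by
  induction α using FreeMonoid.inductionOn' with
  | one => simp only [evalWord_one, opTensor_one_one]
  | of_mul i β ih => simp only [evalWord_mul, evalWord_of, ih, opTensor_mul]

open Classical in
theorem inner_evalWord {S : Fin n → BOp E}
    (hS : ∀ i j x y, inner ℂ (S i x) (S j y) = if i = j then inner ℂ x y else 0)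
    {α β : FreeMonoid (Fin n)} (h : α.length = β.length) (x y : E) :
    inner ℂ (evalWord S α x) (evalWord S β y) = if α = β then inner ℂ x y else 0 := by
  induction α using FreeMonoid.inductionOn' generalizing β with
  | one =>
    obtain rfl := FreeMonoid.length_eq_zero.1 (h.symm.trans FreeMonoid.length_one)
    simp [evalWord_one]
  | of_mul i γ ih =>
    induction β using FreeMonoid.inductionOn' with
    | one => simp [FreeMonoid.length_mul, FreeMonoid.length_of] at h
    | of_mul j δ _ =>
      simp only [FreeMonoid.length_mul, FreeMonoid.length_of, add_right_inj] at h
      rw [evalWord_mul, evalWord_mul, evalWord_of, evalWord_of, mul_apply_eq_comp,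
        mul_apply_eq_comp, hS]
      have hiff : FreeMonoid.of i * γ = FreeMonoid.of j * δ ↔ i = j ∧ γ = δ :=
        ⟨fun h => by simpa using congrArg FreeMonoid.toList h, fun h => by rw [h.1, h.2]⟩
      by_cases hij : i = j
      · by_cases hγ : γ = δ
        · rw [if_pos hij, ih h, if_pos hγ, if_pos (hiff.2 ⟨hij, hγ⟩)]
        · rw [if_pos hij, ih h, if_neg hγ, if_neg fun h' => hγ (hiff.1 h').2]
      · rw [if_neg hij, if_neg fun h' => hij (hiff.1 h').1]

variable [CompleteSpace E]

open Classical in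
theorem star_evalWord_mul {S : Fin n → BOp E}
    (hS : ∀ i j x y, inner ℂ (S i x) (S j y) = if i = j then inner ℂ x y else 0)
    {α β : FreeMonoid (Fin n)} (h : α.length = β.length) :
    star (evalWord S α) * evalWord S β = if α = β then 1 else 0 := by
  ext y
  refine ext_inner_left ℂ fun x => ?_
  rw [mul_apply_eq_comp, ContinuousLinearMap.star_eq_adjoint,
    ContinuousLinearMap.adjoint_inner_right, inner_evalWord hS h]
  split_ifs <;> simp

variable [CompleteSpace F] {H : Type*} [NormedAddCommGroup H] [InnerProductSpace ℂ H]
  [CompleteSpace H]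

/-- Words of equal length in the `S_i` have orthogonal ranges, so the square of the sum has no cross
terms. A separate bound `‖Γ_α‖ ≤ 1` for each word therefore suffices, and the rest is the column
estimate for the `Y_α`. -/
theorem norm_sum_opTensor_le {S : Fin n → BOp E} {Y : Fin n → BOp F}
    {Γ : FreeMonoid (Fin n) → BOp H} {ρ : ℝ}
    (hS : ∀ i j x y, inner ℂ (S i x) (S j y) = if i = j then inner ℂ x y else 0)
    (hY : ‖rowOp (fun i => star (Y i))‖ ≤ ρ) {k : ℕ} (hΓ : ∀ α ∈ words n k, ‖Γ α‖ ≤ 1) :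
    ‖∑ α ∈ words n k, opTensor (evalWord (fun i => opTensor (S i) (Y i)) α) (Γ α)‖ ≤ ρ ^ k := by
  classical
  have hρ : 0 ≤ ρ := (ContinuousLinearMap.opNorm_nonneg _).trans hY
  set X : Fin n → BOp (HilbertTensor E F) := fun i => opTensor (S i) (Y i)
  have hX : ∀ α ∈ words n k, ∀ β ∈ words n k, star (evalWord X α) * evalWord X β
      = if α = β then opTensor 1 (star (evalWord Y α) * evalWord Y α) else 0 := by
    intro α hα β hβ
    rw [evalWord_opTensor, evalWord_opTensor, star_opTensor, ← opTensor_mul,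
      star_evalWord_mul hS ((mem_words.1 hα).trans (mem_words.1 hβ).symm)]
    split_ifs with h
    · rw [h]
    · rw [opTensor_zero_left]
  have hW : star (∑ α ∈ words n k, opTensor (evalWord X α) (Γ α))
      * ∑ α ∈ words n k, opTensor (evalWord X α) (Γ α)
      = ∑ α ∈ words n k,
        star (opTensor (evalWord X α) (Γ α)) * opTensor (evalWord X α) (Γ α) := by
    rw [star_sum, Finset.sum_mul_sum]
    refine Finset.sum_congr rfl fun α hα => ?_
    refine Finset.sum_eq_single_of_mem α hα fun β hβ h => ?_
    rw [star_opTensor, ← opTensor_mul, hX α hα β hβ, if_neg h.symm, opTensor_zero_left]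
  -- With every `Γ_α` replaced by the identity, the sum collapses to `1 ⊗ (∑ Y_α^* Y_α) ⊗ 1`.
  have hone : ‖∑ α ∈ words n k, star (opTensor (evalWord X α) (1 : BOp H))
      * opTensor (evalWord X α) (1 : BOp H)‖ ≤ (ρ ^ 2) ^ k := by
    have : ∑ α ∈ words n k, star (opTensor (evalWord X α) (1 : BOp H))
        * opTensor (evalWord X α) (1 : BOp H)
        = opTensor (opTensor 1 (∑ α ∈ words n k, star (evalWord Y α) * evalWord Y α)) 1 := by
      rw [opTensor_sum_right, opTensor_sum_left]
      refine Finset.sum_congr rfl fun α hα => ?_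
      rw [star_opTensor, ← opTensor_mul, hX α hα α hα, if_pos rfl, star_one, one_mul]
    rw [this]
    have hYk := norm_sum_star_mul_self_le (q := (ρ ^ 2) ^ k) (by positivity)
      (sum_norm_sq_evalWord_le (sq_nonneg ρ) (sum_norm_sq_le_of_norm_rowOp_le hY) k)
    calc _ ≤ ‖opTensor (1 : BOp E) (∑ α ∈ words n k, star (evalWord Y α) * evalWord Y α)‖
          * ‖(1 : BOp H)‖ := norm_opTensor_le _ _
      _ ≤ ‖opTensor (1 : BOp E) (∑ α ∈ words n k, star (evalWord Y α) * evalWord Y α)‖ :=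
          mul_le_of_le_one_right (norm_nonneg _) ContinuousLinearMap.norm_id_le
      _ ≤ ‖(1 : BOp E)‖ * ‖∑ α ∈ words n k, star (evalWord Y α) * evalWord Y α‖ :=
          norm_opTensor_le _ _
      _ ≤ ‖∑ α ∈ words n k, star (evalWord Y α) * evalWord Y α‖ :=
          mul_le_of_le_one_left (norm_nonneg _) ContinuousLinearMap.norm_id_le
      _ ≤ _ := hYk
  refine ContinuousLinearMap.opNorm_le_bound _ (by positivity) fun z => ?_
  refine (sq_le_sq₀ (norm_nonneg _) (by positivity)).1 ?_
  rw [← re_inner_star_mul_self, hW, sum_apply, inner_sum, Complex.re_sum]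
  calc ∑ α ∈ words n k, (inner ℂ z ((star (opTensor (evalWord X α) (Γ α))
        * opTensor (evalWord X α) (Γ α)) z)).re
      ≤ ∑ α ∈ words n k, (inner ℂ z ((star (opTensor (evalWord X α) (1 : BOp H))
        * opTensor (evalWord X α) (1 : BOp H)) z)).re := by
        refine Finset.sum_le_sum fun α hα => ?_
        rw [re_inner_star_mul_self, re_inner_star_mul_self]
        have h1 : opTensor (evalWord X α) (Γ α)
            = opTensor 1 (Γ α) * opTensor (evalWord X α) 1 := by
          rw [← opTensor_mul, one_mul, mul_one]
        have h2 : ‖opTensor (1 : BOp (HilbertTensor E F)) (Γ α)‖ ≤ 1 :=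
          (norm_opTensor_le _ _).trans
            (mul_le_one₀ ContinuousLinearMap.norm_id_le (norm_nonneg _) (hΓ α hα))
        rw [h1, mul_apply_eq_comp]
        gcongr
        exact (ContinuousLinearMap.le_opNorm _ _).trans
          (mul_le_of_le_one_left (norm_nonneg _) h2)
    _ = (inner ℂ z ((∑ α ∈ words n k, star (opTensor (evalWord X α) (1 : BOp H))
        * opTensor (evalWord X α) (1 : BOp H)) z)).re := by
        rw [sum_apply, inner_sum, Complex.re_sum]
    _ ≤ (ρ ^ 2) ^ k * ‖z‖ ^ 2 := (re_inner_le_norm_mul_sq _ _).trans (by gcongr)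
    _ = (ρ ^ k * ‖z‖) ^ 2 := by ring

end WordTensor

/-! ### Factoring the coefficients through a square root -/

section Factorization

variable {ι H : Type*} [NormedAddCommGroup H] [InnerProductSpace ℂ H]

theorem IsDominated.re_inner_le {s : Finset ι} {C : ι → BOp H} {B : BOp H}
    (h : IsDominated s C B) {i : ι} (hi : i ∈ s) (x y : H) :
    (inner ℂ y (C i x)).re ≤ (inner ℂ x (B x)).re + (inner ℂ y (B y)).re := by
  classical
  have h1 := h x (Pi.single i y)
  rw [Finset.sum_eq_single_of_mem i hi, Finset.sum_eq_single_of_mem i hi, Pi.single_eq_same] at h1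
  · exact h1
  · intro j _ hj
    simp [Pi.single_eq_of_ne hj]
  · intro j _ hj
    simp [Pi.single_eq_of_ne hj]

variable [CompleteSpace H]

/-- Let `g = b⁻¹` and `z = (1/2) g C g x`. The hypothesis at `g x` and `g z` reads `2‖z‖² ≤ ‖x‖² +
‖z‖²`, because `B ≤ b²` gives `⟪g u, B (g u)⟫ ≤ ‖u‖²`. -/
theorem norm_smul_conj_inverse_le_one {B C b : BOp H} {ε : ℝ} (hε : 0 ≤ ε) (hb : IsSelfAdjoint b)
    (hu : IsUnit b) (hbb : b * b = B + ε • 1)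
    (h : ∀ x y, (inner ℂ y (C x)).re ≤ (inner ℂ x (B x)).re + (inner ℂ y (B y)).re) :
    ‖(1 / 2 : ℝ) • (Ring.inverse b * C * Ring.inverse b)‖ ≤ 1 := by
  set g := Ring.inverse b
  have hg : star g = g := by rw [← Ring.inverse_star, hb.star_eq]
  have hgs : ∀ u v : H, inner ℂ u (g v) = inner ℂ (g u) v := fun u v => by
    rw [← ContinuousLinearMap.adjoint_inner_left, ← ContinuousLinearMap.star_eq_adjoint, hg]
  have hB : ∀ x, (inner ℂ (g x) (B (g x))).re ≤ ‖x‖ ^ 2 := fun x => by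
    have h1 : (inner ℂ (g x) ((star b * b) (g x))).re = ‖b (g x)‖ ^ 2 :=
      re_inner_star_mul_self b (g x)
    have h2 : b (g x) = x := by
      rw [← mul_apply_eq_comp, Ring.mul_inverse_cancel _ hu, one_apply_eq_self]
    rw [hb.star_eq, hbb, h2, add_apply, smul_apply, one_apply_eq_self, inner_add_right,
      inner_smul_right_eq_smul, Complex.add_re, Complex.smul_re, smul_eq_mul] at h1
    have h3 : 0 ≤ (inner ℂ (g x) (g x)).re := inner_self_nonneg (𝕜 := ℂ)
    nlinarith [mul_nonneg hε h3]
  refine ContinuousLinearMap.opNorm_le_bound _ zero_le_one fun x => ?_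
  rw [one_mul]
  set z := ((1 / 2 : ℝ) • (g * C * g)) x with hz
  have h1 : (inner ℂ (g z) (C (g x))).re = 2 * ‖z‖ ^ 2 := by
    have h2 : (g * C * g) x = (2 : ℝ) • z := by
      rw [hz, smul_apply, smul_smul]
      norm_num
    have h3 : inner ℂ (g z) (C (g x)) = inner ℂ z ((g * C * g) x) := by
      rw [mul_assoc, mul_apply_eq_comp, mul_apply_eq_comp]
      exact (hgs z (C (g x))).symm
    rw [h3, h2, inner_smul_right_eq_smul, Complex.smul_re, smul_eq_mul]
    exact congrArg (2 * ·) (inner_self_eq_norm_sq (𝕜 := ℂ) z)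
  have h4 := h (g x) (g z)
  rw [h1] at h4
  have h5 := hB x
  have h6 := hB z
  exact (sq_le_sq₀ (norm_nonneg _) (norm_nonneg _)).1 (by linarith)

/-- The operator is `V^* diag(1, D) V` for the column `V = (c, b)`, and `V^* V = t`. -/
theorem norm_mul_self_add_conj_le {c b D : BOp H} {t : ℝ} (ht : 0 ≤ t) (hc : IsSelfAdjoint c)
    (hb : IsSelfAdjoint b) (h : c * c + b * b = (t : ℂ) • 1) (hD : ‖D‖ ≤ 1) :
    ‖c * c + b * D * b‖ ≤ t := by
  have hsq : ∀ x, ‖c x‖ ^ 2 + ‖b x‖ ^ 2 = t * ‖x‖ ^ 2 := fun x => by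
    rw [← re_inner_star_mul_self, ← re_inner_star_mul_self, hc.star_eq, hb.star_eq,
      ← Complex.add_re, ← inner_add_right, ← add_apply, h, smul_apply,
      inner_smul_right, Complex.re_ofReal_mul, one_apply_eq_self]
    exact congrArg (t * ·) (inner_self_eq_norm_sq (𝕜 := ℂ) x)
  refine ContinuousLinearMap.opNorm_le_bound _ ht fun x => ?_
  set y := (c * c + b * D * b) x with hy
  have h1 : ‖y‖ ^ 2 ≤ ‖c y‖ * ‖c x‖ + ‖b y‖ * ‖b x‖ := by
    have h2 : ‖y‖ ^ 2 = (inner ℂ (c y) (c x)).re + (inner ℂ (b y) (D (b x))).re := by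
      have e1 : inner ℂ (c y) (c x) = inner ℂ y (c (c x)) := by
        conv_rhs => rw [← hc.star_eq, ContinuousLinearMap.star_eq_adjoint,
          ContinuousLinearMap.adjoint_inner_right, ← ContinuousLinearMap.star_eq_adjoint,
          hc.star_eq]
      have e2 : inner ℂ (b y) (D (b x)) = inner ℂ y (b (D (b x))) := by
        rw [← ContinuousLinearMap.adjoint_inner_right, ← ContinuousLinearMap.star_eq_adjoint,
          hb.star_eq]
      rw [e1, e2, ← Complex.add_re, ← inner_add_right]
      exact (inner_self_eq_norm_sq (𝕜 := ℂ) y).symm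
    rw [h2]
    refine add_le_add ((Complex.re_le_norm _).trans (norm_inner_le_norm _ _))
      ((Complex.re_le_norm _).trans ((norm_inner_le_norm _ _).trans ?_))
    gcongr
    exact (D.le_opNorm _).trans (mul_le_of_le_one_left (norm_nonneg _) hD)
  -- Cauchy–Schwarz in the plane, with the two lengths given by `hsq`.
  have h3 : ‖c y‖ * ‖c x‖ + ‖b y‖ * ‖b x‖ ≤ t * ‖x‖ * ‖y‖ := by
    refine abs_le_of_sq_le_sq' ?_ (by positivity) |>.2
    have : (t * ‖x‖ * ‖y‖) ^ 2
        = (‖c x‖ ^ 2 + ‖b x‖ ^ 2) * (‖c y‖ ^ 2 + ‖b y‖ ^ 2) := by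
      rw [hsq, hsq]
      ring
    rw [this]
    nlinarith [sq_nonneg (‖c y‖ * ‖b x‖ - ‖b y‖ * ‖c x‖)]
  rcases (norm_nonneg y).eq_or_lt with h0 | h0
  · rw [← h0]
    positivity
  · nlinarith

end Factorization

/-! ### The value `F(S_1 ⊗ Y_1, …, S_n ⊗ Y_n)` -/

section Value

variable {n : ℕ} {H : Type*} [NormedAddCommGroup H] [InnerProductSpace ℂ H]
  {A : FreeMonoid (Fin n) → BOp H}

theorem homPart_zero {E : Type*} [NormedAddCommGroup E] [InnerProductSpace ℂ E]
    (X : Fin n → BOp E) : homPart A X 0 = opTensor 1 (A 1) := by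
  rw [homPart, words_zero, Finset.sum_singleton, evalWord_one]

theorem homPart_eq_of_factorization {E : Type*} [NormedAddCommGroup E] [InnerProductSpace ℂ E]
    (X : Fin n → BOp E) {b : BOp H} {Γ : FreeMonoid (Fin n) → BOp H} {k : ℕ}
    (hA : ∀ α ∈ words n k, A α = (2 : ℂ) • (b * Γ α * b)) :
    homPart A X k = opTensor 1 b *
      ((2 : ℂ) • ∑ α ∈ words n k, opTensor (evalWord X α) (Γ α)) * opTensor 1 b := by
  rw [homPart, mul_smul_comm, smul_mul_assoc, Finset.mul_sum, Finset.sum_mul, Finset.smul_sum]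
  refine Finset.sum_congr rfl fun α hα => ?_
  rw [hA α hα, opTensor_smul_right, ← opTensor_mul, ← opTensor_mul, one_mul, mul_one]

variable [CompleteSpace H]

/-- The operator `1 - A 1` need not be invertible; adding `ε` makes its square root `b` invertible,
at the cost of `1 + ε` in place of `1`. -/
theorem exists_factorization (h1 : A 1 ≤ 1)
    (h : ∀ k, 1 ≤ k → IsDominated (words n k) A (1 - A 1)) {ε : ℝ} (hε : 0 < ε) :
    ∃ (b : BOp H) (Γ : FreeMonoid (Fin n) → BOp H), IsSelfAdjoint b ∧
      A 1 + b * b = (1 + ε) • (1 : BOp H) ∧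
      ∀ k, 1 ≤ k → ∀ α ∈ words n k, ‖Γ α‖ ≤ 1 ∧ A α = (2 : ℂ) • (b * Γ α * b) := by
  have hpos : IsStrictlyPositive ((1 - A 1) + ε • (1 : BOp H)) := by
    refine IsStrictlyPositive.nonneg_add (sub_nonneg.2 h1) ?_
    rw [← Algebra.algebraMap_eq_smul_one]
    exact isStrictlyPositive_algebraMap hε
  set b := CFC.sqrt ((1 - A 1) + ε • (1 : BOp H)) with hbdef
  have hb : IsSelfAdjoint b := IsSelfAdjoint.of_nonneg (CFC.sqrt_nonneg _)
  have hbb : b * b = (1 - A 1) + ε • (1 : BOp H) := CFC.sqrt_mul_sqrt_self _ hpos.nonneg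
  have hu : IsUnit b := IsStrictlyPositive.isUnit_cfcSqrt _ hpos
  refine ⟨b, fun α => (1 / 2 : ℝ) • (Ring.inverse b * A α * Ring.inverse b), hb, ?_,
    fun k hk α hα => ⟨?_, ?_⟩⟩
  · rw [hbb]
    module
  · exact norm_smul_conj_inverse_le_one hε.le hb hu hbb fun x y => (h k hk).re_inner_le hα x y
  · rw [mul_smul_comm, smul_mul_assoc, mul_assoc (Ring.inverse b), ← mul_assoc b,
      Ring.mul_inverse_cancel _ hu, one_mul, mul_assoc, Ring.inverse_mul_cancel _ hu, mul_one]
    module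

theorem exists_hasValue_and_norm_le_one {E F : Type*} [NormedAddCommGroup E]
    [InnerProductSpace ℂ E] [CompleteSpace E] [NormedAddCommGroup F] [InnerProductSpace ℂ F]
    [CompleteSpace F] {S : Fin n → BOp E} {Y : Fin n → BOp F}
    (hS : ∀ i j x y, inner ℂ (S i x) (S j y) = if i = j then inner ℂ x y else 0)
    (hY : ‖rowOp (fun i => star (Y i))‖ ≤ 1 / 3) (h0 : 0 ≤ A 1) (h1 : A 1 ≤ 1)
    (h : ∀ k, 1 ≤ k → IsDominated (words n k) A (1 - A 1)) :
    ∃ L, HasValue A (fun i => opTensor (S i) (Y i)) L ∧ ‖L‖ ≤ 1 := by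
  set X : Fin n → BOp (HilbertTensor E F) := fun i => opTensor (S i) (Y i)
  -- This series has sum exactly `1`, which is where the radius `1/3` comes from.
  have hg := (hasSum_pow_succ (r := 1 / 3) (by norm_num) (by norm_num)).mul_left 2
  have hterm : ∀ {Γ : FreeMonoid (Fin n) → BOp H},
      (∀ k, 1 ≤ k → ∀ α ∈ words n k, ‖Γ α‖ ≤ 1) → ∀ k : ℕ,
      ‖(2 : ℂ) • ∑ α ∈ words n (k + 1), opTensor (evalWord X α) (Γ α)‖
        ≤ 2 * (1 / 3) ^ (k + 1) := fun hΓ k => by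
    rw [norm_smul, Complex.norm_ofNat]
    gcongr
    exact norm_sum_opTensor_le hS hY (hΓ (k + 1) (by omega))
  have hsum : Summable (homPart A X) := by
    -- Any fixed `ε` serves for convergence, since the size of `b` is irrelevant there; `ε = 1` is
    -- taken.
    obtain ⟨b, Γ, -, -, hΓ⟩ := exists_factorization h1 h one_pos
    refine (summable_nat_add_iff 1).1 (Summable.of_norm_bounded
      ((hg.summable.mul_left ‖opTensor (1 : BOp (HilbertTensor E F)) b‖).mul_right
        ‖opTensor (1 : BOp (HilbertTensor E F)) b‖) fun k => ?_)
    rw [homPart_eq_of_factorization X fun α hα => (hΓ (k + 1) (by omega) α hα).2]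
    refine (norm_mul_le _ _).trans ?_
    gcongr
    refine (norm_mul_le _ _).trans ?_
    gcongr
    exact hterm (fun k hk α hα => (hΓ k hk α hα).1) k
  have hbound : ∀ ε : ℝ, 0 < ε → ∀ N, ‖∑ k ∈ Finset.range (N + 1), homPart A X k‖ ≤ 1 + ε := by
    intro ε hε N
    obtain ⟨b, Γ, hb, hbb, hΓ⟩ := exists_factorization h1 h hε
    have hc : IsSelfAdjoint (CFC.sqrt (A 1)) := IsSelfAdjoint.of_nonneg (CFC.sqrt_nonneg _)
    have hcc : CFC.sqrt (A 1) * CFC.sqrt (A 1) = A 1 := CFC.sqrt_mul_sqrt_self _ h0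
    have hsa : ∀ {a : BOp H}, IsSelfAdjoint a →
        IsSelfAdjoint (opTensor (1 : BOp (HilbertTensor E F)) a) := fun {a} ha => by
      rw [IsSelfAdjoint, star_opTensor, star_one, ha.star_eq]
    have hmul : ∀ a : BOp H, opTensor (1 : BOp (HilbertTensor E F)) a * opTensor 1 a
        = opTensor 1 (a * a) := fun a => by rw [← opTensor_mul, one_mul]
    have hone : opTensor (1 : BOp (HilbertTensor E F)) (CFC.sqrt (A 1))
        * opTensor 1 (CFC.sqrt (A 1)) + opTensor 1 b * opTensor 1 b
        = ((1 + ε : ℝ) : ℂ) • 1 := by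
      rw [hmul, hmul, hcc, ← opTensor_add_right, hbb, ← Complex.coe_smul, opTensor_smul_right,
        opTensor_one_one]
    have hD : ‖∑ k ∈ Finset.range N,
        (2 : ℂ) • ∑ α ∈ words n (k + 1), opTensor (evalWord X α) (Γ α)‖ ≤ 1 := by
      refine (norm_sum_le _ _).trans ((Finset.sum_le_sum fun k _ =>
        hterm (fun k hk α hα => (hΓ k hk α hα).1) k).trans
        ((hg.summable.sum_le_tsum _ fun k _ => by positivity).trans ?_))
      rw [hg.tsum_eq]
      norm_num
    -- Applied with `c = 1 ⊗ √(A 1)`, whose square is the constant term of the partial sum.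
    have hle := norm_mul_self_add_conj_le (by linarith) (hsa hc) (hsa hb) hone hD
    rw [hmul, hcc, Finset.mul_sum, Finset.sum_mul] at hle
    rw [Finset.sum_range_succ', homPart_zero, add_comm]
    convert hle using 3
    exact Finset.sum_congr rfl fun k _ =>
      homPart_eq_of_factorization X fun α hα => (hΓ (k + 1) (by omega) α hα).2
  have hL := hsum.hasSum.tendsto_sum_nat
  refine ⟨_, hL, ?_⟩
  have hL' := (continuous_norm.tendsto _).comp ((Filter.tendsto_add_atTop_iff_nat 1).2 hL)
  exact le_of_forall_pos_le_add fun ε hε => le_of_tendsto' hL' (hbound ε hε)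

end Value

end

end NCBohr

theorem theorem2p5 {n : ℕ} (hn : 1 ≤ n)
    {H : Type u} [NormedAddCommGroup H] [InnerProductSpace ℂ H] [CompleteSpace H]
    (A : FreeMonoid (Fin n) → (H →L[ℂ] H))
    (hF : NCBohr.IsHolomorphicOnBall.{v, u} A)
    (hF0 : NCBohr.NonnegAtZero.{v, u} A)
    (hRe : NCBohr.ReLeOneOnBall.{v, u} A) :
    (∀ (𝒦 : Type w) [NormedAddCommGroup 𝒦] [InnerProductSpace ℂ 𝒦] [CompleteSpace 𝒦]
      (Y : Fin n → (𝒦 →L[ℂ] 𝒦)), ‖NCBohr.rowOp (fun i => star (Y i))‖ ≤ 1 / 3 →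
        ∃ L, NCBohr.HasValue A (fun i => NCBohr.opTensor (NCBohr.creation i) (Y i)) L ∧
          ‖L‖ ≤ 1) ∧
    (∀ k : ℕ, 1 ≤ k → NCBohr.coeffSq A k ≤ (4 : ℝ) • (1 - A 1)) ∧
    (∀ k : ℕ, 1 ≤ k → √‖NCBohr.coeffSq A k‖ ≤ 2 * ‖1 - A 1‖) ∧
    (∀ r : ℝ, 0 ≤ r → r < 1 →
      Summable (fun k : ℕ => r ^ k • CFC.sqrt (NCBohr.coeffSq A k)) ∧
      ∑' k : ℕ, r ^ k • CFC.sqrt (NCBohr.coeffSq A k) ≤ NCBohr.M r • (1 : H →L[ℂ] H)) ∧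
    (‖A 1‖ < 1 → IsUnit (1 - A 1) ∧ ∀ r : ℝ, 0 ≤ r → r < 1 →
      Summable (fun k : ℕ => ∑ α ∈ NCBohr.words n (k + 1),
        r ^ (k + 1) • (star (A α) * Ring.inverse (1 - A 1) * A α)) ∧
      A 1 + ∑' k : ℕ, ∑ α ∈ NCBohr.words n (k + 1),
        r ^ (k + 1) • (star (A α) * Ring.inverse (1 - A 1) * A α)
          ≤ NCBohr.K r • (1 : H →L[ℂ] H)) ∧
    (∀ r : ℝ, 0 ≤ r → r ≤ 1 / 3 →
      Summable (fun k : ℕ => r ^ k * √‖NCBohr.coeffSq A k‖) ∧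
      ∑' k : ℕ, r ^ k * √‖NCBohr.coeffSq A k‖ ≤ ‖A 1‖ + ‖1 - A 1‖) := by
  have h0 := NCBohr.coeff_one_nonneg hF0
  have h1 := NCBohr.coeff_one_le_one hF hF0 hRe
  have h : ∀ k, 1 ≤ k → NCBohr.IsDominated (NCBohr.words n k) A (1 - A 1) :=
    fun k hk x y => NCBohr.re_inner_coeff_le hF hRe hk x y
  exact ⟨fun 𝒦 _ _ _ Y hY =>
      NCBohr.exists_hasValue_and_norm_le_one NCBohr.inner_creation hY h0 h1 h,
    fun k hk => NCBohr.coeffSq_le h0 h1 (h k hk),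
    fun k hk => NCBohr.sqrt_norm_coeffSq_le h1 (h k hk),
    fun r hr0 hr1 => NCBohr.summable_and_tsum_sqrt_coeffSq_le h0 h1 h hr0 hr1,
    fun hA => ⟨isUnit_one_sub_of_norm_lt_one hA, fun r hr0 hr1 =>
      NCBohr.summable_and_tsum_inverse_le h0 h1 h (isUnit_one_sub_of_norm_lt_one hA) hr0 hr1⟩,
    fun r hr0 hr1 => NCBohr.summable_and_tsum_sqrt_norm_coeffSq_le h1 h hr0 hr1⟩
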